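/- Conventions. Let $(X,d)$ be a metric space. For $A\subseteq X$ let $|A|=\sup_{a,b\in A}d(a,b)$ be its diameter and let $B(x,r)$ be the open ball. $X$ is *uniformly perfect* if there is $c\in(0,1)$ such that $B(x,R)\setminus B(x,cR)\neq\varnothing$ for all $x\in X$ and all real $R$ with $0<R<|X|$. For $\delta>0$, $N_\delta(F)$ is the smallest number of open balls of $X$ with diameter at most $\delta$ whose union contains $F$. The *Assouad dimension* $\dim_{\mathrm A}F$ of a non-empty $F\subseteq X$ is the infimum of those $\alpha$ for which there is $C>0$ with $N_r(B(x,R)\cap F)\le C(R/r)^\alpha$ for all $x\in F$ and $0<r<R$. The *upper box dimension* of a non-empty, totally bounded $F$ is $\overline{\dim}_{\mathrm B}F=\limsup_{\delta\to0^+}\frac{\log N_\delta(F)}{-\log\delta}$. A real function $\Phi$ is *admissible* if for some $Y_0>0$ it is defined on $(0,Y_0)$, satisfies $0<\Phi(\delta)\le\delta$ there, is monotonic on $(0,Y_0)$, and $\Phi(\delta)/\delta\to0$ as $\delta\to0^+$. For an admissible $\Phi$ and a non-empty, totally bounded $F$, the *upper $\Phi$-intermediate dimension* $\overline{\dim}^\Phi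 F$ is the infimum of those $s\ge0$ such that for all $\varepsilon>0$ there is $\delta_0\in(0,1]$ such that for all $\delta\in(0,\delta_0)$ there is a finite or countable cover $\{U_i\}$ of $F$ by bounded subsets of $X$ with $\Phi(\delta)\le|U_i|\le\delta$ for all $i$ and $\sum_i|U_i|^s\le\varepsilon$. The *lower $\Phi$-intermediate dimension* $\underline{\dim}^\Phi F$ is the infimum of those $s\ge0$ such that for all $\varepsilon>0$ and all $\delta_0\in(0,1]$ there are $\delta\in(0,\delta_0)$ and such a cover. All infima are taken in $[-\infty,\infty]$, with $\inf\varnothing=\infty$. Theorem 5.5. Let $(X,d_X)$ and $(Y,d_Y)$ be uniformly perfect metric spaces with more than one point, and let $d_{X\times Y}$ be a metric on $X\times Y$ such that, for some constants $c_1,c_2\in(0,\infty)$, $$c_1\max(d_X,d_Y)\le d_{X\times Y}\le c_2\max(d_X,d_Y).$$ Then $(X\times Y,d_{X\times Y})$ is a uniformly perfect metric space with more than one point. Moreover, if $E\subseteq X$ and $F\subseteq Y$ are non-empty, totally bounded subsets with finite Assouad dimension, then $E\times F$ is a non-empty, totally bounded subset of $(X\times Y,d_{X\times Y})$ and $\dim_{\mathrm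 A}(E\times F)<\infty$, and for every admissible $\Phi$ we have $\underline{\dim}^\Phi(E\times F)\le\overline{\dim}^\Phi(E\times F)$ and (i) $\max\{\overline{\dim}^\Phi E+\underline{\dim}^\Phi F,\ \underline{\dim}^\Phi E+\overline{\dim}^\Phi F\}\le\overline{\dim}^\Phi(E\times F)\le\min\{\overline{\dim}^\Phi E+\overline{\dim}_{\mathrm B}F,\ \overline{\dim}_{\mathrm B}E+\overline{\dim}^\Phi F\}$; (ii) $\underline{\dim}^\Phi E+\underline{\dim}^\Phi F\le\underline{\dim}^\Phi(E\times F)\le\min\{\underline{\dim}^\Phi E+\overline{\dim}_{\mathrm B}F,\ \overline{\dim}_{\mathrm B}E+\underline{\dim}^\Phi F\}$. In the case of self-products (that is, for a metric on $Y\times Y$ comparable in the above sense to the maximum metric, and a non-empty, totally bounded $F\subseteq Y$ with $\dim_{\mathrm A}F<\infty$), we have $\underline{\dim}^\Phi(F\times F)\le\overline{\dim}^\Phi(F\times F)$ and (iii) $2\,\overline{\dim}^\Phi F\le\overline{\dim}^\Phi(F\times F)\le\overline{\dim}^\Phi F+\overline{\dim}_{\mathrm B}F$; (iv) $2\,\underline{\dim}^\Phi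 F\le\underline{\dim}^\Phi(F\times F)\le\underline{\dim}^\Phi F+\overline{\dim}_{\mathrm B}F$. -/

import Mathlib

open scoped Topology

namespace PhiInter

/-- The metric space `X` is uniformly perfect: for some `c ∈ (0,1)`, whenever `0 < R < |X|`
(the diameter `|X|` is `∞` if `X` is unbounded), the set `B(x,R) \ B(x,cR)` is non-empty
for every `x`. -/
def UniformlyPerfect (X : Type*) [MetricSpace X] : Prop :=
  ∃ c : ℝ, 0 < c ∧ c < 1 ∧ ∀ (x : X) (R : ℝ), 0 < R →
    ENNReal.ofReal R < Metric.ediam (Set.univ : Set X) →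
      (Metric.ball x R \ Metric.ball x (c * R)).Nonempty

/-- `N_δ(F)`: the smallest number (possibly `∞`) of open balls of the ambient space `X`, of
diameter at most `δ`, whose union contains `F`. -/
noncomputable def coveringNum {X : Type*} [MetricSpace X] (δ : ℝ) (F : Set X) : ℕ∞ :=
  ⨅ (𝒰 : Set (Set X)) (_ : F ⊆ ⋃₀ 𝒰 ∧
    ∀ U ∈ 𝒰, (∃ (x : X) (r : ℝ), 0 < r ∧ U = Metric.ball x r) ∧ Metric.diam U ≤ δ), 𝒰.encard

/-- The Assouad dimension. As everywhere below, the infimum is taken in the extended reals, so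
that the infimum of the empty set is `∞`. -/
noncomputable def assouadDim {X : Type*} [MetricSpace X] (F : Set X) : EReal :=
  sInf ((fun α : ℝ => (α : EReal)) '' {α : ℝ | ∃ C : ℝ, 0 < C ∧
    ∀ x ∈ F, ∀ r R : ℝ, 0 < r → r < R →
      ((coveringNum r (Metric.ball x R ∩ F) : ENNReal)) ≤ ENNReal.ofReal (C * (R / r) ^ α)})

/-- The upper box dimension: the upper limit of `log N_δ(F) / (- log δ)` as `δ → 0⁺`, with values
in the extended reals. -/
noncomputable def upperBoxDim {X : Type*} [MetricSpace X] (F : Set X) : EReal :=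
  Filter.limsup (fun δ : ℝ =>
    ENNReal.log (coveringNum δ F : ENNReal) / ((-Real.log δ : ℝ) : EReal)) (𝓝[>] (0 : ℝ))

/-- Admissible functions. Only the values of `Φ` at small positive reals matter. -/
def Admissible (Φ : ℝ → ℝ) : Prop :=
  ∃ Y : ℝ, 0 < Y ∧ (∀ δ ∈ Set.Ioo 0 Y, 0 < Φ δ ∧ Φ δ ≤ δ) ∧
    Filter.Tendsto (fun δ => Φ δ / δ) (𝓝[>] (0 : ℝ)) (𝓝 0) ∧
    (MonotoneOn Φ (Set.Ioo 0 Y) ∨ AntitoneOn Φ (Set.Ioo 0 Y))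

/-- `F` has a finite or countable cover by bounded sets `U` with `a ≤ |U| ≤ b` for every `U` in
the cover and `∑ |U|^s ≤ ε`. -/
def HasCover {X : Type*} [MetricSpace X] (F : Set X) (a b s ε : ℝ) : Prop :=
  ∃ 𝒰 : Set (Set X), 𝒰.Countable ∧ F ⊆ ⋃₀ 𝒰 ∧
    (∀ U ∈ 𝒰, Bornology.IsBounded U ∧ a ≤ Metric.diam U ∧ Metric.diam U ≤ b) ∧
    ∑' U : 𝒰, ENNReal.ofReal (Metric.diam (U : Set X) ^ s) ≤ ENNReal.ofReal ε

/-- The upper `Φ`-intermediate dimension. -/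
noncomputable def upperDim {X : Type*} [MetricSpace X] (Φ : ℝ → ℝ) (F : Set X) : EReal :=
  sInf ((fun s : ℝ => (s : EReal)) '' {s : ℝ | 0 ≤ s ∧ ∀ ε : ℝ, 0 < ε →
    ∃ δ₀ : ℝ, 0 < δ₀ ∧ δ₀ ≤ 1 ∧ ∀ δ : ℝ, 0 < δ → δ < δ₀ → HasCover F (Φ δ) δ s ε})

/-- The lower `Φ`-intermediate dimension. -/
noncomputable def lowerDim {X : Type*} [MetricSpace X] (Φ : ℝ → ℝ) (F : Set X) : EReal :=
  sInf ((fun s : ℝ => (s : EReal)) '' {s : ℝ | 0 ≤ s ∧ ∀ ε : ℝ, 0 < ε →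
    ∀ δ₀ : ℝ, 0 < δ₀ → δ₀ ≤ 1 → ∃ δ : ℝ, 0 < δ ∧ δ < δ₀ ∧ HasCover F (Φ δ) δ s ε})

/-- The metric `m` on `X × Y` (in general not the one that Mathlib puts on a product) satisfies
`c₁ max(d_X, d_Y) ≤ d_{X × Y} ≤ c₂ max(d_X, d_Y)` for some constants `c₁, c₂ ∈ (0,∞)`. -/
def ComparableToMax {X Y : Type*} [MetricSpace X] [MetricSpace Y]
    (m : MetricSpace (X × Y)) : Prop :=
  ∃ c₁ c₂ : ℝ, 0 < c₁ ∧ 0 < c₂ ∧ ∀ p q : X × Y,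
    c₁ * max (dist p.1 q.1) (dist p.2 q.2) ≤ m.dist p q ∧
    m.dist p q ≤ c₂ * max (dist p.1 q.1) (dist p.2 q.2)

end PhiInter

/-!
All covers are replaced by finite covers of `F` by closed balls centred in `F` with radii in
`[a, b]` (`BallCover`). A cover by arbitrary sets of diameter at least `a` gives such balls, finite
in number since `F` has a finite `a`-net (`HasCover.ballCover`); conversely uniform perfectness
keeps the diameter of a ball comparable to its radius (`BallCover.hasCover`). Both changes cost
constant factors in the range of radii. Finite Assouad dimension makes `F` doubling, so that such
factors can be undone by enlarging small balls and splitting large ones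
(`exists_ballCover_rescale`), as soon as `Φ δ / δ` is small. Hence the dimensions are infima of
exponents defined through ball covers with radii in `[Φ δ, δ]` (`upperDim_eq_sInf`,
`lowerDim_eq_sInf`).

*Upper bounds.* Multiply each ball of radius `r` in a cover of `E` by an `r`-net of `F`, which has
at most `r ^ (-t)` points when `t` exceeds the upper box dimension of `F`
(`IsComparableProd.ballCover_of_fst`).

*Lower bounds.* Take a cover of `E × F` with small `∑ r ^ (s + t)`, at a fixed scale `δ`. Its
members that meet `{x} × F` project to a cover of `F`; so if no cover of `F` at this scale has
`∑ r ^ t` below `ε`, then the projections to `X`, with weights `r ^ t`, cover every `x ∈ E` with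
total weight at least `ε`. Such a fractional cover can be turned into a cover, with no loss but that
the balls are enlarged five times, by repeated use of the Vitali covering lemma
(`exists_cover_of_weighted`); this takes the place of a Frostman measure. So at each scale either
`E` has a cover with small `∑ r ^ s` or `F` has one with small `∑ r ^ t`
(`IsComparableProd.ballCover_fst_or_snd`). Reading this for all small `δ`, or for arbitrarily small
`δ`, gives the bounds for products; for `F × F` and `s = t` both alternatives say the same, which
gives the stronger bound for self-products.

The metric on the product is not the instance on `X × Y`, so everything is proved for a metric
space `Z` with a bijection `Z ≃ X × Y` (`IsComparableProd`).
-/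

namespace PhiInter

open Filter Metric

/-! ### Nets, covering numbers and doubling -/

section Nets

variable {X : Type*} [MetricSpace X]

/-- `S` has an `r`-net consisting of at most `n` of its own points; `n` is a real number so that
power-law bounds can be used without rounding. -/
def HasNet (S : Set X) (r n : ℝ) : Prop :=
  ∃ T : Finset X, ↑T ⊆ S ∧ (T.card : ℝ) ≤ n ∧ ∀ y ∈ S, ∃ z ∈ T, dist y z ≤ r

theorem hasNet_of_finset_cover {ι : Type*} {S : Set X} {r n : ℝ} (t : Finset ι) (A : ι → Set X)
    (hcov : ∀ y ∈ S, ∃ i ∈ t, y ∈ A i)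
    (hA : ∀ i ∈ t, ∀ y ∈ A i, ∀ z ∈ A i, dist y z ≤ r) (hn : (t.card : ℝ) ≤ n) :
    HasNet S r n := by
  classical
  let W := t.filter fun i => (A i ∩ S).Nonempty
  have hW : ∀ i ∈ W, (A i ∩ S).Nonempty := fun i hi => (Finset.mem_filter.1 hi).2
  let g : W → X := fun i => (hW i.1 i.2).some
  have hg : ∀ i : W, g i ∈ A i.1 ∩ S := fun i => (hW i.1 i.2).some_mem
  refine ⟨Finset.univ.image g, ?_, ?_, ?_⟩
  · intro z hz
    simp only [Finset.coe_image, Finset.coe_univ, Set.image_univ, Set.mem_range] at hz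
    obtain ⟨i, rfl⟩ := hz
    exact (hg i).2
  · refine le_trans ?_ hn
    have h1 : (Finset.univ.image g).card ≤ W.card := by
      simpa using (Finset.card_image_le (s := Finset.univ) (f := g))
    exact_mod_cast h1.trans (Finset.card_filter_le _ _)
  · intro y hy
    obtain ⟨i, hit, hyi⟩ := hcov y hy
    have hiW : i ∈ W := Finset.mem_filter.2 ⟨hit, y, hyi, hy⟩
    exact ⟨g ⟨i, hiW⟩, Finset.mem_image_of_mem _ (Finset.mem_univ _),
      hA i hit y hyi _ (hg ⟨i, hiW⟩).1⟩

theorem hasNet_of_coveringNum_le {S : Set X} {δ B : ℝ} (hB : 0 ≤ B)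
    (h : (coveringNum δ S : ENNReal) ≤ ENNReal.ofReal B) : HasNet S δ B := by
  have hfin : coveringNum δ S ≠ ⊤ := by
    intro htop
    rw [htop] at h
    simp at h
  obtain ⟨n, hn⟩ := ENat.ne_top_iff_exists.mp hfin
  have hnB : (n : ℝ) ≤ B := by
    rw [← hn, ENat.toENNReal_coe, ← ENNReal.ofReal_natCast] at h
    exact (ENNReal.ofReal_le_ofReal_iff hB).1 h
  have hlt : coveringNum δ S < ((n + 1 : ℕ) : ℕ∞) := by
    rw [← hn]
    exact_mod_cast Nat.lt_succ_self n
  unfold coveringNum at hlt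
  obtain ⟨𝒰, hlt⟩ := iInf_lt_iff.1 hlt
  obtain ⟨⟨hcov, hU⟩, hlt⟩ := iInf_lt_iff.1 hlt
  have hfinU : 𝒰.Finite := Set.finite_of_encard_le_coe hlt.le
  obtain ⟨V, rfl⟩ := hfinU.exists_finset_coe
  rw [Set.encard_coe_eq_coe_finsetCard] at hlt
  have hVn : V.card ≤ n := by
    have : V.card < n + 1 := by exact_mod_cast hlt
    omega
  refine hasNet_of_finset_cover V id (fun y hy => ?_) (fun U hUV y hy z hz => ?_)
    (le_trans (by exact_mod_cast hVn) hnB)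
  · obtain ⟨U, hUV, hyU⟩ := hcov hy
    exact ⟨U, hUV, hyU⟩
  · obtain ⟨⟨x, r, -, hball⟩, hdiam⟩ := hU U hUV
    have hbdd : Bornology.IsBounded U := by
      rw [hball]
      exact isBounded_ball
    exact (dist_le_diam_of_mem hbdd hy hz).trans hdiam

theorem HasNet.coveringNum_le {S : Set X} {r n : ℝ} (h : HasNet S r n) (hr : 0 < r) :
    (coveringNum (4 * r) S : ENNReal) ≤ ENNReal.ofReal n := by
  classical
  obtain ⟨T, -, hcard, hT⟩ := h
  let 𝒰 : Finset (Set X) := T.image fun z => ball z (2 * r)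
  have h1 : coveringNum (4 * r) S ≤ (𝒰 : Set (Set X)).encard := by
    refine iInf₂_le _ ⟨?_, ?_⟩
    · intro y hy
      obtain ⟨z, hz, hyz⟩ := hT y hy
      refine ⟨ball z (2 * r), Finset.mem_coe.2 (Finset.mem_image_of_mem _ hz), ?_⟩
      rw [mem_ball]
      linarith
    · intro U hU
      obtain ⟨z, -, rfl⟩ := Finset.mem_image.1 (Finset.mem_coe.1 hU)
      refine ⟨⟨z, 2 * r, by linarith, rfl⟩, (diam_ball (by linarith)).trans (by linarith)⟩
  have h2 : coveringNum (4 * r) S ≤ (T.card : ℕ∞) := by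
    refine h1.trans ?_
    rw [Set.encard_coe_eq_coe_finsetCard]
    exact_mod_cast Finset.card_image_le
  calc (coveringNum (4 * r) S : ENNReal) ≤ ((T.card : ℕ∞) : ENNReal) := by exact_mod_cast h2
    _ = ENNReal.ofReal (T.card : ℝ) := by simp
    _ ≤ ENNReal.ofReal n := ENNReal.ofReal_le_ofReal hcard

/-- Up to a change of constants, the Assouad dimension may be computed with nets instead of
balls of small diameter. -/
theorem assouadDim_lt_top_iff {F : Set X} :
    assouadDim F < ⊤ ↔ ∃ α C : ℝ, 0 < C ∧ ∀ x ∈ F, ∀ r R : ℝ, 0 < r → r < R →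
      HasNet (ball x R ∩ F) r (C * (R / r) ^ α) := by
  constructor
  · intro h
    obtain ⟨_, ⟨α, ⟨C, hC, hα⟩, rfl⟩, -⟩ := sInf_lt_iff.1 h
    refine ⟨α, C, hC, fun x hx r R hr hrR => hasNet_of_coveringNum_le ?_ (hα x hx r R hr hrR)⟩
    have : 0 < R := hr.trans hrR
    positivity
  · rintro ⟨α, C, hC, h⟩
    suffices hα : assouadDim F ≤ (α : EReal) from hα.trans_lt (EReal.coe_lt_top α)
    refine sInf_le ⟨α, ⟨C * 4 ^ α, by positivity, ?_⟩, rfl⟩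
    intro x hx r R hr hrR
    have h1 := (h x hx (r / 4) R (by linarith) (by linarith)).coveringNum_le (by linarith)
    have hR : 0 < R := hr.trans hrR
    have h2 : R / (r / 4) = 4 * (R / r) := by field_simp
    rwa [mul_div_cancel₀ r (by norm_num), h2, Real.mul_rpow (by norm_num) (by positivity),
      ← mul_assoc] at h1

/-- For every `K`, the part of `F` in a ball centred in `F` is covered by boundedly many balls
with the same property whose radii are `K` times smaller. -/
def Doubling (F : Set X) : Prop :=
  ∀ K : ℝ, 1 ≤ K → ∃ M : ℝ, 0 < M ∧ ∀ x ∈ F, ∀ r : ℝ, 0 < r →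
    ∃ T : Finset X, ↑T ⊆ F ∧ (T.card : ℝ) ≤ M ∧
      ∀ y ∈ F, dist y x ≤ r → ∃ z ∈ T, dist y z ≤ r / K

theorem doubling_of_assouadDim_lt_top {F : Set X} (h : assouadDim F < ⊤) : Doubling F := by
  obtain ⟨α, C, hC, h⟩ := assouadDim_lt_top_iff.1 h
  intro K hK
  have hK0 : 0 < K := by linarith
  refine ⟨C * (2 * K) ^ α, by positivity, fun x hx r hr => ?_⟩
  have hrK : r / K ≤ r := div_le_self hr.le hK
  obtain ⟨T, hTS, hcard, hT⟩ := h x hx (r / K) (2 * r) (by positivity) (by linarith)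
  refine ⟨T, fun z hz => (hTS hz).2, ?_, fun y hy hyx => hT y ⟨?_, hy⟩⟩
  · have : 2 * r / (r / K) = 2 * K := by field_simp
    rwa [this] at hcard
  · rw [mem_ball]
    linarith

theorem one_le_coveringNum {F : Set X} (hF : F.Nonempty) (δ : ℝ) : 1 ≤ coveringNum δ F := by
  refine le_iInf₂ fun 𝒰 h𝒰 => ?_
  obtain ⟨x, hx⟩ := hF
  obtain ⟨U, hU, -⟩ := h𝒰.1 hx
  exact Set.one_le_encard_iff_nonempty.2 ⟨U, hU⟩

theorem eventually_neg_log_pos : ∀ᶠ δ : ℝ in 𝓝[>] (0 : ℝ), 0 < δ ∧ 0 < -Real.log δ := by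
  filter_upwards [Ioo_mem_nhdsGT (zero_lt_one' ℝ)] with δ hδ
  exact ⟨hδ.1, neg_pos.2 (Real.log_neg hδ.1 hδ.2)⟩

theorem upperBoxDim_nonneg {F : Set X} (hF : F.Nonempty) : 0 ≤ upperBoxDim F := by
  refine le_limsup_of_frequently_le (Eventually.frequently ?_)
  filter_upwards [eventually_neg_log_pos] with δ hδ
  refine EReal.div_nonneg ?_ (by exact_mod_cast hδ.2.le)
  rw [← ENNReal.log_one]
  refine ENNReal.log_le_log ?_
  exact_mod_cast one_le_coveringNum hF δ

theorem eventually_hasNet_of_upperBoxDim_lt {F : Set X} {t : ℝ} (h : upperBoxDim F < t) :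
    ∀ᶠ δ : ℝ in 𝓝[>] (0 : ℝ), HasNet F δ (δ ^ (-t)) := by
  filter_upwards [eventually_lt_of_limsup_lt h, eventually_neg_log_pos] with δ h1 hδ
  have hpos : 0 < δ ^ (-t) := Real.rpow_pos_of_pos hδ.1 _
  refine hasNet_of_coveringNum_le hpos.le ?_
  rw [EReal.div_lt_iff (by exact_mod_cast hδ.2) (EReal.coe_ne_top _)] at h1
  rw [← ENNReal.log_le_log_iff, ENNReal.log_ofReal_of_pos hpos, Real.log_rpow hδ.1]
  refine h1.le.trans (le_of_eq ?_)
  rw [← EReal.coe_mul]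
  congr 1
  ring

end Nets

/-! ### From fractional covers to covers -/

section Weighted

variable {X : Type*} [PseudoMetricSpace X]

/-- From a fractional cover to a cover. If the weights `w i` of the balls that contain a given
point of `E` always sum up to at least `m`, then some of the balls, enlarged five times, cover `E`
at a total cost of at most `m⁻¹ * ∑ w i * v i`. A Vitali subfamily of disjoint balls
uses up at most `l` of the total weight at each point when all its weights are lowered by
`l`; lowering until some weight vanishes gives an induction on the number of balls. -/
theorem exists_cover_of_weighted {ι : Type*} (x : ι → X) (r v : ι → ℝ) (hv : ∀ i, 0 ≤ v i)
    (E : Set X) (t : Finset ι) : ∀ (w : ι → ℝ) (m : ℝ), (∀ i ∈ t, 0 < w i) → 0 < m →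
      (∀ y ∈ E, m ≤ ∑ i ∈ t with dist y (x i) ≤ r i, w i) →
      ∃ u ⊆ t, (∀ y ∈ E, ∃ i ∈ u, dist y (x i) ≤ 5 * r i) ∧
        m * ∑ i ∈ u, v i ≤ ∑ i ∈ t, w i * v i := by
  classical
  induction t using Finset.strongInduction with
  | H t ih =>
  intro w m hw hm hE
  obtain ⟨R, hR⟩ : ∃ R, ∀ i ∈ (t : Set ι), r i ≤ R := by
    obtain ⟨R, hR⟩ := (t.image r).bddAbove
    exact ⟨R, fun i hi => hR (by simpa using ⟨i, hi, rfl⟩)⟩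
  obtain ⟨u', hu't, hdisj, hencl⟩ := Vitali.exists_disjoint_subfamily_covering_enlargement_closedBall
    (t : Set ι) x r R hR 5 (by norm_num)
  obtain ⟨u, rfl⟩ := ((t.finite_toSet).subset hu't).exists_finset_coe
  have hut : u ⊆ t := by exact_mod_cast hu't
  have hcov : ∀ y ∈ E, ∃ i ∈ u, dist y (x i) ≤ 5 * r i := by
    intro y hy
    have hne : (t.filter fun i => dist y (x i) ≤ r i).Nonempty := by
      by_contra hemp
      have := hE y hy
      rw [Finset.not_nonempty_iff_eq_empty.1 hemp, Finset.sum_empty] at this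
      linarith
    obtain ⟨i, hi⟩ := hne
    obtain ⟨hit, hyi⟩ := Finset.mem_filter.1 hi
    obtain ⟨j, hj, hij⟩ := hencl i hit
    exact ⟨j, hj, hij hyi⟩
  rcases u.eq_empty_or_nonempty with rfl | hne
  · refine ⟨∅, hut, hcov, ?_⟩
    simpa using Finset.sum_nonneg fun i hi => mul_nonneg (hw i hi).le (hv i)
  obtain ⟨i₀, hi₀, hmin⟩ := Finset.exists_min_image u w hne
  have hsum_u : ∀ c : ℝ, (∀ i ∈ u, c ≤ w i) → c * ∑ i ∈ u, v i ≤ ∑ i ∈ t, w i * v i := by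
    intro c hc
    rw [Finset.mul_sum]
    refine (Finset.sum_le_sum fun i hi => mul_le_mul_of_nonneg_right (hc i hi) (hv i)).trans ?_
    exact Finset.sum_le_sum_of_subset_of_nonneg hut
      fun i hi _ => mul_nonneg (hw i hi).le (hv i)
  rcases le_or_gt m (w i₀) with hmw | hmw
  · exact ⟨u, hut, hcov, hsum_u m fun i hi => hmw.trans (hmin i hi)⟩
  set l := w i₀ with hl
  have hl0 : 0 < l := hw i₀ (hut hi₀)
  let w' : ι → ℝ := fun i => w i - if i ∈ u then l else 0
  have hw'0 : ∀ i ∈ t, 0 ≤ w' i := by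
    intro i hi
    by_cases hiu : i ∈ u
    · simpa [w', hiu] using hmin i hiu
    · simpa [w', hiu] using (hw i hi).le
  let t' := t.filter fun i => 0 < w' i
  have ht' : t' ⊂ t := by
    refine Finset.filter_ssubset.2 ⟨i₀, hut hi₀, ?_⟩
    simp [w', hi₀, hl]
  have hdrop : ∀ s ⊆ t, ∀ f : ι → ℝ, ∑ i ∈ s with 0 < w' i, w' i * f i = ∑ i ∈ s, w' i * f i := by
    intro s hs f
    refine Finset.sum_subset (Finset.filter_subset _ _) fun i hi hni => ?_
    have : w' i ≤ 0 := by
      by_contra hcon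
      exact hni (Finset.mem_filter.2 ⟨hi, not_le.1 hcon⟩)
    rw [le_antisymm this (hw'0 i (hs hi)), zero_mul]
  have hE' : ∀ y ∈ E, m - l ≤ ∑ i ∈ t' with dist y (x i) ≤ r i, w' i := by
    intro y hy
    have h1 := hdrop (t.filter fun i => dist y (x i) ≤ r i) (Finset.filter_subset _ _) 1
    simp only [Pi.one_apply, mul_one] at h1
    rw [Finset.filter_comm, h1, Finset.sum_sub_distrib]
    -- disjointness: `y` lies in at most one ball of the subfamily `u`
    have h2 : ∑ i ∈ t with dist y (x i) ≤ r i, (if i ∈ u then l else 0) ≤ l := by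
      rw [← Finset.sum_filter, Finset.sum_const, nsmul_eq_mul]
      have hcard : ((t.filter fun i => dist y (x i) ≤ r i).filter (· ∈ u)).card ≤ 1 := by
        refine Finset.card_le_one.2 fun a ha b hb => ?_
        simp only [Finset.mem_filter] at ha hb
        by_contra hab
        exact Set.disjoint_left.1 (hdisj ha.2 hb.2 hab) (mem_closedBall.2 ha.1.2)
          (mem_closedBall.2 hb.1.2)
      have : (((t.filter fun i => dist y (x i) ≤ r i).filter (· ∈ u)).card : ℝ) ≤ 1 := by
        exact_mod_cast hcard
      nlinarith
    linarith [hE y hy]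
  obtain ⟨u₂, hu₂, hcov₂, hsum₂⟩ := ih t' ht' w' (m - l)
    (fun i hi => (Finset.mem_filter.1 hi).2) (by linarith) hE'
  have hsum' : ∑ i ∈ t', w' i * v i = ∑ i ∈ t, w i * v i - l * ∑ i ∈ u, v i := by
    rw [hdrop t (Finset.Subset.refl t) v]
    simp only [w', sub_mul, ite_mul, zero_mul]
    rw [Finset.sum_sub_distrib, ← Finset.sum_filter, Finset.filter_mem_eq_inter,
      Finset.inter_eq_right.2 hut, Finset.mul_sum]
  rw [hsum'] at hsum₂
  rcases le_total (∑ i ∈ u, v i) (∑ i ∈ u₂, v i) with hle | hle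
  · refine ⟨u, hut, hcov, ?_⟩
    nlinarith
  · refine ⟨u₂, hu₂.trans ht'.subset, hcov₂, ?_⟩
    nlinarith

end Weighted

/-! ### Covers by balls -/

section BallCovers

variable {X : Type*} [MetricSpace X]

/-- `F` has a finite cover by closed balls centred in `F`, with radii in `[a, b]` and
`∑ r ^ s ≤ ε`. A ball is recorded by its centre and its radius. -/
def BallCover (F : Set X) (a b s ε : ℝ) : Prop :=
  ∃ t : Finset (X × ℝ), (∀ p ∈ t, p.1 ∈ F ∧ a ≤ p.2 ∧ p.2 ≤ b) ∧
    (∀ y ∈ F, ∃ p ∈ t, dist y p.1 ≤ p.2) ∧ ∑ p ∈ t, p.2 ^ s ≤ ε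

theorem ballCover_of_finset {ι : Type*} {F : Set X} {a b s ε : ℝ} (t : Finset ι) (x : ι → X)
    (r : ι → ℝ) (ha : 0 ≤ a) (ht : ∀ i ∈ t, x i ∈ F ∧ a ≤ r i ∧ r i ≤ b)
    (hcov : ∀ y ∈ F, ∃ i ∈ t, dist y (x i) ≤ r i) (hsum : ∑ i ∈ t, r i ^ s ≤ ε) :
    BallCover F a b s ε := by
  classical
  refine ⟨t.image fun i => (x i, r i), ?_, ?_, ?_⟩
  · intro p hp
    obtain ⟨i, hi, rfl⟩ := Finset.mem_image.1 hp
    exact ht i hi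
  · intro y hy
    obtain ⟨i, hi, hyi⟩ := hcov y hy
    exact ⟨_, Finset.mem_image_of_mem _ hi, hyi⟩
  · refine (Finset.sum_image_le_of_nonneg (f := fun p : X × ℝ => p.2 ^ s) fun p hp => ?_).trans hsum
    obtain ⟨i, hi, rfl⟩ := Finset.mem_image.1 hp
    exact Real.rpow_nonneg (ha.trans (ht i hi).2.1) _

theorem BallCover.mono {F : Set X} {a b s ε ε' : ℝ} (h : BallCover F a b s ε) (hε : ε ≤ ε') :
    BallCover F a b s ε' := by
  obtain ⟨t, h1, h2, h3⟩ := h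
  exact ⟨t, h1, h2, h3.trans hε⟩

theorem one_le_of_ballCover_zero {F : Set X} (hF : F.Nonempty) {a b ε : ℝ}
    (h : BallCover F a b 0 ε) : 1 ≤ ε := by
  obtain ⟨t, -, hcov, hsum⟩ := h
  obtain ⟨x, hx⟩ := hF
  obtain ⟨p, hp, -⟩ := hcov x hx
  have : (1 : ℝ) ≤ t.card := by exact_mod_cast Finset.card_pos.2 ⟨p, hp⟩
  simp only [Real.rpow_zero, Finset.sum_const, nsmul_eq_mul, mul_one] at hsum
  linarith

/-- For a doubling set, the range of radii allowed in a cover may be moved by a bounded factor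
at both ends: small balls are enlarged, and large balls are split up. -/
theorem exists_ballCover_rescale {F : Set X} (hF : Doubling F) {s K : ℝ} (hs : 0 ≤ s)
    (hK : 1 ≤ K) : ∃ C : ℝ, 0 < C ∧ ∀ a b a' b' ε : ℝ, 0 < a → 0 < a' → a' ≤ b' → a' ≤ K * a →
      b ≤ K * b' → BallCover F a b s ε → BallCover F a' b' s (C * ε) := by
  classical
  obtain ⟨M, hM, hdbl⟩ := hF K hK
  refine ⟨M * K ^ s, by positivity, fun a b a' b' ε ha ha' hab' haK hbK h => ?_⟩
  obtain ⟨t, ht, hcov, hsum⟩ := h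
  have hpos : ∀ p ∈ t, 0 < p.2 := fun p hp => ha.trans_le (ht p hp).2.1
  have hT : ∀ p : X × ℝ, ∃ T : Finset X, p ∈ t → ↑T ⊆ F ∧ (T.card : ℝ) ≤ M ∧
      ∀ y ∈ F, dist y p.1 ≤ p.2 → ∃ z ∈ T, dist y z ≤ p.2 / K := by
    intro p
    by_cases hp : p ∈ t
    · obtain ⟨T, hT⟩ := hdbl p.1 (ht p hp).1 p.2 (hpos p hp)
      exact ⟨T, fun _ => hT⟩
    · exact ⟨∅, fun h => absurd h hp⟩
  choose T hT using hT
  let ρ : ℝ → ℝ := fun r => min (max r a') b'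
  refine ballCover_of_finset (t.sigma T) (fun i => i.2) (fun i => ρ i.1.2) ha'.le ?_ ?_ ?_
  · rintro ⟨p, z⟩ hi
    obtain ⟨hp, hz⟩ := Finset.mem_sigma.1 hi
    exact ⟨(hT p hp).1 hz, le_min (le_max_right _ _) hab', min_le_right _ _⟩
  · intro y hy
    obtain ⟨p, hp, hyp⟩ := hcov y hy
    obtain ⟨z, hz, hyz⟩ := (hT p hp).2.2 y hy hyp
    refine ⟨⟨p, z⟩, Finset.mem_sigma.2 ⟨hp, hz⟩, hyz.trans (le_min ?_ ?_)⟩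
    · exact (div_le_self (hpos p hp).le hK).trans (le_max_left _ _)
    · rw [div_le_iff₀ (by linarith)]
      linarith [(ht p hp).2.2]
  · rw [Finset.sum_sigma]
    calc ∑ p ∈ t, ∑ _z ∈ T p, ρ p.2 ^ s ≤ ∑ p ∈ t, M * K ^ s * p.2 ^ s := by
          refine Finset.sum_le_sum fun p hp => ?_
          have hp0 := hpos p hp
          have hρ : ρ p.2 ≤ K * p.2 := by
            refine (min_le_left _ _).trans (max_le ?_ ?_)
            · nlinarith
            · exact haK.trans (mul_le_mul_of_nonneg_left (ht p hp).2.1 (by linarith))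
          have hρ0 : 0 ≤ ρ p.2 := le_min (hp0.le.trans (le_max_left _ _)) (ha'.le.trans hab')
          rw [Finset.sum_const, nsmul_eq_mul, mul_assoc,
            ← Real.mul_rpow (by linarith) hp0.le]
          exact mul_le_mul (hT p hp).2.1 (Real.rpow_le_rpow hρ0 hρ hs)
            (Real.rpow_nonneg hρ0 _) hM.le
      _ = M * K ^ s * ∑ p ∈ t, p.2 ^ s := (Finset.mul_sum _ _ _).symm
      _ ≤ M * K ^ s * ε := mul_le_mul_of_nonneg_left hsum (by positivity)

/-- A member `U` of the cover is replaced by the ball of radius `2 * |U|` about a point of `F ∩ U`;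
the extra radius pays for covering only a net of `F`, by finitely many `U`. -/
theorem HasCover.ballCover {F : Set X} (hF : TotallyBounded F) {a b s ε : ℝ} (ha : 0 < a)
    (hε : 0 ≤ ε) (h : HasCover F a b s ε) : BallCover F (2 * a) (2 * b) s (2 ^ s * ε) := by
  classical
  obtain ⟨𝒰, -, hcov, h𝒰, hsum⟩ := h
  obtain ⟨N, hNF, hNfin, hN⟩ := finite_approx_of_totallyBounded hF a ha
  obtain ⟨N, rfl⟩ := hNfin.exists_finset_coe
  -- keep one member of the cover for each point of an `a`-net of `F`
  have hsel : ∀ p : N, ∃ U : 𝒰, p.1 ∈ U.1 := fun p => by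
    obtain ⟨U, hU, hpU⟩ := hcov (hNF p.2)
    exact ⟨⟨U, hU⟩, hpU⟩
  choose g hg using hsel
  have hV : ∀ U : 𝒰, ∃ x : X, U ∈ Finset.univ.image g → x ∈ F ∧ x ∈ U.1 := by
    intro U
    by_cases hU : U ∈ Finset.univ.image g
    · obtain ⟨p, -, rfl⟩ := Finset.mem_image.1 hU
      exact ⟨p.1, fun _ => ⟨hNF p.2, hg p⟩⟩
    · obtain ⟨x, -⟩ | hemp := U.1.eq_empty_or_nonempty.symm
      · exact ⟨x, fun h => absurd h hU⟩
      · have h1 := (h𝒰 U.1 U.2).2.1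
        rw [hemp, diam_empty] at h1
        linarith
  choose c hc using hV
  refine ballCover_of_finset (Finset.univ.image g) c (fun U => 2 * diam U.1) (by linarith) ?_ ?_ ?_
  · intro U hU
    have := (h𝒰 U.1 U.2).2
    exact ⟨(hc U hU).1, by linarith, by linarith⟩
  · intro y hy
    have hy' := hN hy
    simp only [Set.mem_iUnion, mem_ball, exists_prop] at hy'
    obtain ⟨p, hp, hyp⟩ := hy'
    have hmem : g ⟨p, hp⟩ ∈ Finset.univ.image g := Finset.mem_image_of_mem _ (Finset.mem_univ _)
    refine ⟨g ⟨p, hp⟩, hmem, ?_⟩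
    obtain ⟨hbdd, h1, -⟩ := h𝒰 _ (g ⟨p, hp⟩).2
    have h2 := dist_le_diam_of_mem hbdd (hg ⟨p, hp⟩) (hc _ hmem).2
    dsimp only at h2
    linarith [dist_triangle y p (c (g ⟨p, hp⟩))]
  · have h1 : ∑ U ∈ Finset.univ.image g, diam U.1 ^ s ≤ ε := by
      have h2 := (ENNReal.sum_le_tsum (Finset.univ.image g)).trans hsum
      rw [← ENNReal.ofReal_sum_of_nonneg fun U _ => Real.rpow_nonneg diam_nonneg _] at h2
      exact (ENNReal.ofReal_le_ofReal_iff hε).1 h2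
    calc ∑ U ∈ Finset.univ.image g, (2 * diam U.1) ^ s
        = 2 ^ s * ∑ U ∈ Finset.univ.image g, diam U.1 ^ s := by
          rw [Finset.mul_sum]
          exact Finset.sum_congr rfl fun U _ => Real.mul_rpow (by norm_num) diam_nonneg
      _ ≤ 2 ^ s * ε := mul_le_mul_of_nonneg_left h1 (by positivity)

/-- Uniform perfectness bounds the diameters of small closed balls from below. -/
theorem UniformlyPerfect.exists_le_diam_closedBall [Nontrivial X] (hX : UniformlyPerfect X) :
    ∃ c R : ℝ, 0 < c ∧ 0 < R ∧ ∀ (x : X) (r : ℝ), 0 < r → r < R →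
      c * r ≤ diam (closedBall x r) := by
  obtain ⟨c, hc, -, h⟩ := hX
  obtain ⟨x₀, y₀, hne⟩ := exists_pair_ne X
  refine ⟨c, dist x₀ y₀, hc, dist_pos.2 hne, fun x r hr hrR => ?_⟩
  have hlt : ENNReal.ofReal r < ediam (Set.univ : Set X) := by
    refine lt_of_lt_of_le ?_ (edist_le_ediam_of_mem (Set.mem_univ x₀) (Set.mem_univ y₀))
    rw [edist_dist]
    exact (ENNReal.ofReal_lt_ofReal_iff (dist_pos.2 hne)).2 hrR
  obtain ⟨y, hy1, hy2⟩ := h x r hr hlt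
  rw [mem_ball, not_lt] at hy2
  exact hy2.trans (dist_le_diam_of_mem isBounded_closedBall (ball_subset_closedBall hy1)
    (mem_closedBall_self hr.le))

theorem BallCover.hasCover {F : Set X} {c R : ℝ} (hc : 0 < c)
    (hX : ∀ (x : X) (r : ℝ), 0 < r → r < R → c * r ≤ diam (closedBall x r)) {a b s ε : ℝ}
    (ha : 0 < a) (hb : b < R) (hs : 0 ≤ s) (h : BallCover F (a / c) (b / 2) s ε) :
    HasCover F a b s (2 ^ s * ε) := by
  classical
  obtain ⟨t, ht, hcov, hsum⟩ := h
  have hpos : ∀ p ∈ t, 0 < p.2 := fun p hp => (div_pos ha hc).trans_le (ht p hp).2.1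
  let 𝒰 : Finset (Set X) := t.image fun p => closedBall p.1 p.2
  refine ⟨(𝒰 : Set (Set X)), 𝒰.countable_toSet, ?_, ?_, ?_⟩
  · intro y hy
    obtain ⟨p, hp, hyp⟩ := hcov y hy
    exact ⟨closedBall p.1 p.2, Finset.mem_coe.2 (Finset.mem_image_of_mem _ hp), hyp⟩
  · intro U hU
    obtain ⟨p, hp, rfl⟩ := Finset.mem_image.1 (Finset.mem_coe.1 hU)
    have h1 := (ht p hp).2
    have h0 := hpos p hp
    refine ⟨isBounded_closedBall, ?_, (diam_closedBall h0.le).trans (by linarith)⟩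
    refine le_trans ?_ (hX p.1 p.2 h0 (by linarith))
    rw [mul_comm]
    exact (div_le_iff₀ hc).1 h1.1
  · have h1 := Finset.tsum_subtype 𝒰 fun U => ENNReal.ofReal (diam U ^ s)
    refine (le_of_eq h1).trans ?_
    refine (Finset.sum_image_le_of_nonneg fun _ _ => zero_le).trans ?_
    rw [← ENNReal.ofReal_sum_of_nonneg fun p _ => Real.rpow_nonneg diam_nonneg _]
    refine ENNReal.ofReal_le_ofReal ?_
    calc ∑ p ∈ t, diam (closedBall p.1 p.2) ^ s ≤ ∑ p ∈ t, 2 ^ s * p.2 ^ s := by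
          refine Finset.sum_le_sum fun p hp => ?_
          rw [← Real.mul_rpow (by norm_num) (hpos p hp).le]
          exact Real.rpow_le_rpow diam_nonneg (diam_closedBall (hpos p hp).le) hs
      _ = 2 ^ s * ∑ p ∈ t, p.2 ^ s := (Finset.mul_sum _ _ _).symm
      _ ≤ 2 ^ s * ε := mul_le_mul_of_nonneg_left hsum (by positivity)

end BallCovers

/-! ### The intermediate dimensions through ball covers -/

section Dimensions

variable {X : Type*} [MetricSpace X]

theorem Admissible.eventually_pos {Φ : ℝ → ℝ} (hΦ : Admissible Φ) :
    ∀ᶠ δ : ℝ in 𝓝[>] (0 : ℝ), 0 < δ ∧ 0 < Φ δ := by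
  obtain ⟨Y, hY, h, -, -⟩ := hΦ
  filter_upwards [Ioo_mem_nhdsGT hY] with δ hδ
  exact ⟨hδ.1, (h δ hδ).1⟩

theorem Admissible.eventually_le_mul {Φ : ℝ → ℝ} (hΦ : Admissible Φ) {k : ℝ} (hk : 0 < k) :
    ∀ᶠ δ : ℝ in 𝓝[>] (0 : ℝ), Φ δ ≤ k * δ := by
  obtain ⟨Y, hY, -, h, -⟩ := hΦ
  filter_upwards [h.eventually (ge_mem_nhds hk), self_mem_nhdsWithin] with δ h1 h2
  exact (div_le_iff₀ h2).1 h1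

/-- Along the scales of an admissible function, constant factors in the range of allowed radii
do not matter. -/
theorem exists_eventually_ballCover_rescale {F : Set X} (hF : Doubling F) {Φ : ℝ → ℝ}
    (hΦ : Admissible Φ) {s : ℝ} (hs : 0 ≤ s) {k₁ k₂ l₁ l₂ : ℝ} (hk₁ : 0 < k₁)
    (hl₁ : 0 < l₁) (hl₂ : 0 < l₂) : ∃ C : ℝ, 0 < C ∧
      ∀ᶠ δ : ℝ in 𝓝[>] (0 : ℝ), ∀ ε : ℝ, BallCover F (k₁ * Φ δ) (k₂ * δ) s ε →
        BallCover F (l₁ * Φ δ) (l₂ * δ) s (C * ε) := by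
  let K := max 1 (max (l₁ / k₁) (k₂ / l₂))
  obtain ⟨C, hC, h⟩ := exists_ballCover_rescale hF hs (le_max_left 1 (max (l₁ / k₁) (k₂ / l₂)))
  refine ⟨C, hC, ?_⟩
  filter_upwards [hΦ.eventually_pos, hΦ.eventually_le_mul (div_pos hl₂ hl₁)] with δ h1 h2 ε
  refine h _ _ _ _ ε (mul_pos hk₁ h1.2) (mul_pos hl₁ h1.2) ?_ ?_ ?_
  · calc l₁ * Φ δ ≤ l₁ * (l₂ / l₁ * δ) := mul_le_mul_of_nonneg_left h2 hl₁.le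
      _ = l₂ * δ := by field_simp
  · have : l₁ / k₁ ≤ K := (le_max_left _ _).trans (le_max_right _ _)
    rw [div_le_iff₀ hk₁] at this
    rw [← mul_assoc]
    exact mul_le_mul_of_nonneg_right this h1.2.le
  · have : k₂ / l₂ ≤ K := (le_max_right _ _).trans (le_max_right _ _)
    rw [div_le_iff₀ hl₂] at this
    rw [← mul_assoc]
    exact mul_le_mul_of_nonneg_right this h1.1.le

theorem exists_eventually_ballCover_of_hasCover {F : Set X} (hF : Doubling F)
    (hFb : TotallyBounded F) {Φ : ℝ → ℝ} (hΦ : Admissible Φ) {s : ℝ} (hs : 0 ≤ s) :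
    ∃ C : ℝ, 0 < C ∧ ∀ᶠ δ : ℝ in 𝓝[>] (0 : ℝ), ∀ ε : ℝ, 0 < ε → HasCover F (Φ δ) δ s ε →
      BallCover F (Φ δ) δ s (C * ε) := by
  obtain ⟨C, hC, h⟩ := exists_eventually_ballCover_rescale hF hΦ hs (k₁ := 2) (k₂ := 2)
    (l₁ := 1) (l₂ := 1) (by norm_num) (by norm_num) (by norm_num)
  refine ⟨C * 2 ^ s, by positivity, ?_⟩
  filter_upwards [h, hΦ.eventually_pos] with δ h1 h2 ε hε hcov
  simpa [mul_assoc] using h1 _ (hcov.ballCover hFb h2.2 hε.le)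

theorem exists_eventually_hasCover_of_ballCover [Nontrivial X] (hX : UniformlyPerfect X)
    {F : Set X} (hF : Doubling F) {Φ : ℝ → ℝ} (hΦ : Admissible Φ) {s : ℝ} (hs : 0 ≤ s) :
    ∃ C : ℝ, 0 < C ∧ ∀ᶠ δ : ℝ in 𝓝[>] (0 : ℝ), ∀ ε : ℝ, 0 < ε → BallCover F (Φ δ) δ s ε →
      HasCover F (Φ δ) δ s (C * ε) := by
  obtain ⟨c, R, hc, hR, hX⟩ := hX.exists_le_diam_closedBall
  obtain ⟨C, hC, h⟩ := exists_eventually_ballCover_rescale hF hΦ hs (k₁ := 1) (k₂ := 1)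
    (l₁ := 1 / c) (l₂ := 1 / 2) (by norm_num) (by positivity) (by norm_num)
  refine ⟨2 ^ s * C, by positivity, ?_⟩
  filter_upwards [h, hΦ.eventually_pos, Ioo_mem_nhdsGT hR] with δ h1 h2 h3 ε _ hcov
  have h4 := h1 ε (by simpa using hcov)
  rw [one_div_mul_eq_div, one_div_mul_eq_div] at h4
  rw [mul_assoc]
  exact h4.hasCover hc hX h2.2 h3.2 hs

theorem eventually_nhdsGT_zero_iff {p : ℝ → Prop} :
    (∀ᶠ δ in 𝓝[>] (0 : ℝ), p δ) ↔
      ∃ δ₀ : ℝ, 0 < δ₀ ∧ δ₀ ≤ 1 ∧ ∀ δ : ℝ, 0 < δ → δ < δ₀ → p δ := by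
  constructor
  · intro h
    obtain ⟨u, hu, hsub⟩ := mem_nhdsGT_iff_exists_Ioo_subset.1 h
    exact ⟨min u 1, lt_min hu one_pos, min_le_right _ _,
      fun δ h1 h2 => hsub ⟨h1, h2.trans_le (min_le_left _ _)⟩⟩
  · rintro ⟨u, hu, -, h⟩
    filter_upwards [Ioo_mem_nhdsGT hu] with δ hδ
    exact h δ hδ.1 hδ.2

theorem frequently_nhdsGT_zero_iff {p : ℝ → Prop} :
    (∃ᶠ δ in 𝓝[>] (0 : ℝ), p δ) ↔
      ∀ δ₀ : ℝ, 0 < δ₀ → δ₀ ≤ 1 → ∃ δ : ℝ, 0 < δ ∧ δ < δ₀ ∧ p δ := by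
  rw [Filter.Frequently, eventually_nhdsGT_zero_iff]
  push Not
  rfl

/-- The exponents whose infimum is the upper `Φ`-intermediate dimension, in terms of covers by
balls. -/
def upperExponents (Φ : ℝ → ℝ) (F : Set X) : Set ℝ :=
  {s | 0 ≤ s ∧ ∀ ε : ℝ, 0 < ε → ∀ᶠ δ in 𝓝[>] (0 : ℝ), BallCover F (Φ δ) δ s ε}

/-- The exponents whose infimum is the lower `Φ`-intermediate dimension, in terms of covers by
balls. -/
def lowerExponents (Φ : ℝ → ℝ) (F : Set X) : Set ℝ :=
  {s | 0 ≤ s ∧ ∀ ε : ℝ, 0 < ε → ∃ᶠ δ in 𝓝[>] (0 : ℝ), BallCover F (Φ δ) δ s ε}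

theorem forall_eventually_of_scaled {P Q : ℝ → ℝ → Prop} {l : Filter ℝ} {C : ℝ} (hC : 0 < C)
    (h : ∀ᶠ δ in l, ∀ ε : ℝ, 0 < ε → P δ ε → Q δ (C * ε))
    (hP : ∀ ε : ℝ, 0 < ε → ∀ᶠ δ in l, P δ ε) : ∀ ε : ℝ, 0 < ε → ∀ᶠ δ in l, Q δ ε := by
  intro ε hε
  filter_upwards [h, hP (ε / C) (by positivity)] with δ h1 h2
  have := h1 _ (by positivity) h2
  rwa [mul_div_cancel₀ ε hC.ne'] at this

theorem forall_frequently_of_scaled {P Q : ℝ → ℝ → Prop} {l : Filter ℝ} {C : ℝ} (hC : 0 < C)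
    (h : ∀ᶠ δ in l, ∀ ε : ℝ, 0 < ε → P δ ε → Q δ (C * ε))
    (hP : ∀ ε : ℝ, 0 < ε → ∃ᶠ δ in l, P δ ε) : ∀ ε : ℝ, 0 < ε → ∃ᶠ δ in l, Q δ ε := by
  intro ε hε
  refine ((hP (ε / C) (by positivity)).and_eventually h).mono fun δ hδ => ?_
  have := hδ.2 _ (by positivity) hδ.1
  rwa [mul_div_cancel₀ ε hC.ne'] at this

theorem upperDim_eq_sInf [Nontrivial X] (hX : UniformlyPerfect X) {F : Set X} (hF : Doubling F)
    (hFb : TotallyBounded F) {Φ : ℝ → ℝ} (hΦ : Admissible Φ) :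
    upperDim Φ F = sInf ((fun s : ℝ => (s : EReal)) '' upperExponents Φ F) := by
  unfold upperDim
  congr 2
  ext s
  simp only [upperExponents, Set.mem_ofPred_eq, ← eventually_nhdsGT_zero_iff]
  refine and_congr_right fun hs => ⟨fun h => ?_, fun h => ?_⟩
  · obtain ⟨C, hC, h1⟩ := exists_eventually_ballCover_of_hasCover hF hFb hΦ hs
    exact forall_eventually_of_scaled hC h1 h
  · obtain ⟨C, hC, h1⟩ := exists_eventually_hasCover_of_ballCover hX hF hΦ hs
    exact forall_eventually_of_scaled hC h1 h

theorem lowerDim_eq_sInf [Nontrivial X] (hX : UniformlyPerfect X) {F : Set X} (hF : Doubling F)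
    (hFb : TotallyBounded F) {Φ : ℝ → ℝ} (hΦ : Admissible Φ) :
    lowerDim Φ F = sInf ((fun s : ℝ => (s : EReal)) '' lowerExponents Φ F) := by
  unfold lowerDim
  congr 2
  ext s
  simp only [lowerExponents, Set.mem_ofPred_eq, ← frequently_nhdsGT_zero_iff]
  refine and_congr_right fun hs => ⟨fun h => ?_, fun h => ?_⟩
  · obtain ⟨C, hC, h1⟩ := exists_eventually_ballCover_of_hasCover hF hFb hΦ hs
    exact forall_frequently_of_scaled hC h1 h
  · obtain ⟨C, hC, h1⟩ := exists_eventually_hasCover_of_ballCover hX hF hΦ hs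
    exact forall_frequently_of_scaled hC h1 h

theorem lowerDim_le_upperDim (Φ : ℝ → ℝ) (F : Set X) : lowerDim Φ F ≤ upperDim Φ F := by
  refine sInf_le_sInf (Set.image_mono fun s hs => ⟨hs.1, fun ε hε => ?_⟩)
  exact frequently_nhdsGT_zero_iff.1 (eventually_nhdsGT_zero_iff.2 (hs.2 ε hε)).frequently

theorem zero_notMem_upperExponents {F : Set X} (hF : F.Nonempty) (Φ : ℝ → ℝ) :
    0 ∉ upperExponents Φ F := by
  intro h
  obtain ⟨δ, hδ⟩ := (h.2 (1 / 2) (by norm_num)).exists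
  linarith [one_le_of_ballCover_zero hF hδ]

theorem zero_notMem_lowerExponents {F : Set X} (hF : F.Nonempty) (Φ : ℝ → ℝ) :
    0 ∉ lowerExponents Φ F := by
  intro h
  obtain ⟨δ, hδ⟩ := (h.2 (1 / 2) (by norm_num)).exists
  linarith [one_le_of_ballCover_zero hF hδ]

end Dimensions

/-! ### Products with a metric comparable to the maximum metric -/

section Products

variable {X Y Z : Type*} [MetricSpace X] [MetricSpace Y] [MetricSpace Z]

/-- `Z` is the product of `X` and `Y` through the bijection `e`, and its metric is comparable to
the maximum metric. A type `Z` of its own keeps a metric on the product apart from the instance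
that Mathlib puts on `X × Y`. -/
structure IsComparableProd (e : Z ≃ X × Y) (c₁ c₂ : ℝ) : Prop where
  pos₁ : 0 < c₁
  pos₂ : 0 < c₂
  lower : ∀ p q : Z, c₁ * max (dist (e p).1 (e q).1) (dist (e p).2 (e q).2) ≤ dist p q
  upper : ∀ p q : Z, dist p q ≤ c₂ * max (dist (e p).1 (e q).1) (dist (e p).2 (e q).2)

namespace IsComparableProd

variable {e : Z ≃ X × Y} {c₁ c₂ : ℝ}

theorem swap (h : IsComparableProd e c₁ c₂) :
    IsComparableProd (e.trans (Equiv.prodComm X Y)) c₁ c₂ where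
  pos₁ := h.pos₁
  pos₂ := h.pos₂
  lower p q := by simpa [max_comm] using h.lower p q
  upper p q := by simpa [max_comm] using h.upper p q

theorem dist_fst_le (h : IsComparableProd e c₁ c₂) (p q : Z) :
    dist (e p).1 (e q).1 ≤ dist p q / c₁ := by
  rw [le_div_iff₀ h.pos₁, mul_comm]
  exact (mul_le_mul_of_nonneg_left (le_max_left _ _) h.pos₁.le).trans (h.lower p q)

theorem dist_snd_le (h : IsComparableProd e c₁ c₂) (p q : Z) :
    dist (e p).2 (e q).2 ≤ dist p q / c₁ := by
  rw [le_div_iff₀ h.pos₁, mul_comm]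
  exact (mul_le_mul_of_nonneg_left (le_max_right _ _) h.pos₁.le).trans (h.lower p q)

theorem dist_le (h : IsComparableProd e c₁ c₂) {p q : Z} {r : ℝ}
    (h₁ : dist (e p).1 (e q).1 ≤ r) (h₂ : dist (e p).2 (e q).2 ≤ r) : dist p q ≤ c₂ * r :=
  (h.upper p q).trans (mul_le_mul_of_nonneg_left (max_le h₁ h₂) h.pos₂.le)

theorem annulus_nonempty (h : IsComparableProd e c₁ c₂) (z : Z) {c R : ℝ} (hR : 0 < R)
    (hne : (ball (e z).1 R \ ball (e z).1 (c * R)).Nonempty) :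
    (ball z (c₂ * R) \ ball z (c₁ * (c * R))).Nonempty := by
  obtain ⟨x, hx1, hx2⟩ := hne
  rw [mem_ball] at hx1 hx2
  have hx : e (e.symm (x, (e z).2)) = (x, (e z).2) := e.apply_symm_apply _
  refine ⟨e.symm (x, (e z).2), ?_, ?_⟩
  · rw [mem_ball]
    refine (h.upper _ _).trans_lt (mul_lt_mul_of_pos_left ?_ h.pos₂)
    rw [hx, dist_self]
    exact max_lt hx1 hR
  · rw [mem_ball, not_lt]
    refine le_trans (mul_le_mul_of_nonneg_left ?_ h.pos₁.le) (h.lower _ _)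
    rw [hx]
    exact (not_lt.1 hx2).trans (le_max_left _ _)

theorem uniformlyPerfect (h : IsComparableProd e c₁ c₂) (hX : UniformlyPerfect X)
    (hY : UniformlyPerfect Y) : UniformlyPerfect Z := by
  obtain ⟨a, ha, -, hX⟩ := hX
  obtain ⟨b, hb, -, hY⟩ := hY
  have h₁ := h.pos₁
  have h₂ := h.pos₂
  refine ⟨min (min (c₁ * a / c₂) (c₁ * b / c₂)) (1 / 2), by positivity,
    (min_le_right _ _).trans_lt (by norm_num), fun z R hR hlt => ?_⟩
  set k := min (min (c₁ * a / c₂) (c₁ * b / c₂)) (1 / 2) with hk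
  have hR' : 0 < R / c₂ := div_pos hR h₂
  -- the witness is moved in a factor whose diameter exceeds `R / c₂`
  have hor : ENNReal.ofReal (R / c₂) < ediam (Set.univ : Set X) ∨
      ENNReal.ofReal (R / c₂) < ediam (Set.univ : Set Y) := by
    by_contra! hcon
    refine absurd hlt (not_lt.2 (ediam_le fun p _ q _ => ?_))
    rw [edist_dist]
    refine ENNReal.ofReal_le_ofReal ?_
    have hp1 := (edist_le_ediam_of_mem (Set.mem_univ (e p).1) (Set.mem_univ (e q).1)).trans hcon.1
    have hp2 := (edist_le_ediam_of_mem (Set.mem_univ (e p).2) (Set.mem_univ (e q).2)).trans hcon.2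
    rw [edist_dist, ENNReal.ofReal_le_ofReal_iff hR'.le] at hp1 hp2
    refine (h.dist_le hp1 hp2).trans (le_of_eq ?_)
    field_simp
  have hc₂ : c₂ * (R / c₂) = R := by field_simp
  rcases hor with hlt' | hlt'
  · have hne := h.annulus_nonempty z hR' (hX (e z).1 (R / c₂) hR' hlt')
    rw [hc₂] at hne
    refine hne.mono (Set.sdiff_subset_sdiff_right (ball_subset_ball ?_))
    calc k * R ≤ c₁ * a / c₂ * R :=
          mul_le_mul_of_nonneg_right ((min_le_left _ _).trans (min_le_left _ _)) hR.le
      _ = c₁ * (a * (R / c₂)) := by ring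
  · have hne := h.swap.annulus_nonempty z hR' (hY (e z).2 (R / c₂) hR' hlt')
    rw [hc₂] at hne
    refine hne.mono (Set.sdiff_subset_sdiff_right (ball_subset_ball ?_))
    calc k * R ≤ c₁ * b / c₂ * R :=
          mul_le_mul_of_nonneg_right ((min_le_left _ _).trans (min_le_right _ _)) hR.le
      _ = c₁ * (b * (R / c₂)) := by ring

theorem totallyBounded (h : IsComparableProd e c₁ c₂) {E : Set X} {F : Set Y}
    (hE : TotallyBounded E) (hF : TotallyBounded F) : TotallyBounded (e ⁻¹' (E ×ˢ F)) := by
  rw [totallyBounded_iff] at hE hF ⊢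
  intro ε hε
  have h₂ := h.pos₂
  obtain ⟨S, hSfin, hS⟩ := hE (ε / (2 * c₂)) (by positivity)
  obtain ⟨T, hTfin, hT⟩ := hF (ε / (2 * c₂)) (by positivity)
  refine ⟨e.symm '' (S ×ˢ T), (hSfin.prod hTfin).image _, fun z hz => ?_⟩
  have hx := hS hz.1
  have hy := hT hz.2
  simp only [Set.mem_iUnion, mem_ball, exists_prop] at hx hy ⊢
  obtain ⟨x, hxS, hx⟩ := hx
  obtain ⟨y, hyT, hy⟩ := hy
  refine ⟨e.symm (x, y), ⟨(x, y), ⟨hxS, hyT⟩, rfl⟩, ?_⟩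
  have h1 : dist z (e.symm (x, y)) ≤ c₂ * (ε / (2 * c₂)) :=
    h.dist_le (by simpa using hx.le) (by simpa using hy.le)
  have h3 : c₂ * (ε / (2 * c₂)) = ε / 2 := by field_simp
  linarith

theorem assouadDim_lt_top (h : IsComparableProd e c₁ c₂) {E : Set X} {F : Set Y}
    (hE : assouadDim E < ⊤) (hF : assouadDim F < ⊤) : assouadDim (e ⁻¹' (E ×ˢ F)) < ⊤ := by
  obtain ⟨α, C, hC, hE⟩ := assouadDim_lt_top_iff.1 hE
  obtain ⟨β, D, hD, hF⟩ := assouadDim_lt_top_iff.1 hF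
  have h₁ := h.pos₁
  have h₂ := h.pos₂
  -- the factor `1 / (2 * c₁)` makes `k * r < R / c₁` whenever `r < R`
  obtain ⟨k, hk, hk₁, hk₂⟩ : ∃ k : ℝ, 0 < k ∧ k ≤ 1 / (2 * c₁) ∧ k ≤ 1 / (2 * c₂) :=
    ⟨min (1 / (2 * c₁)) (1 / (2 * c₂)), by positivity, min_le_left _ _, min_le_right _ _⟩
  rw [le_div_iff₀ (by positivity)] at hk₁ hk₂
  let q := 1 / (c₁ * k)
  have hq : 0 < q := by positivity
  refine assouadDim_lt_top_iff.2 ⟨α + β, C * q ^ α * (D * q ^ β), by positivity, ?_⟩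
  intro z hz r R hr hrR
  have hR : 0 < R := hr.trans hrR
  have hkr : k * r < R / c₁ := by
    rw [lt_div_iff₀ h₁]
    nlinarith
  have hratio : R / c₁ / (k * r) = q * (R / r) := by
    simp only [q]
    field_simp
  obtain ⟨S, -, hScard, hS⟩ := hE (e z).1 hz.1 (k * r) (R / c₁) (by positivity) hkr
  obtain ⟨T, -, hTcard, hT⟩ := hF (e z).2 hz.2 (k * r) (R / c₁) (by positivity) hkr
  rw [hratio, Real.mul_rpow hq.le (by positivity)] at hScard hTcard
  refine hasNet_of_finset_cover (S ×ˢ T)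
    (fun p => {w | dist (e w).1 p.1 ≤ k * r ∧ dist (e w).2 p.2 ≤ k * r}) ?_ ?_ ?_
  · rintro w ⟨hwz, hw⟩
    rw [mem_ball] at hwz
    have hwR : dist w z / c₁ < R / c₁ := div_lt_div_of_pos_right hwz h₁
    obtain ⟨x, hx, hwx⟩ := hS (e w).1 ⟨(h.dist_fst_le w z).trans_lt hwR, hw.1⟩
    obtain ⟨y, hy, hwy⟩ := hT (e w).2 ⟨(h.dist_snd_le w z).trans_lt hwR, hw.2⟩
    exact ⟨(x, y), Finset.mem_product.2 ⟨hx, hy⟩, hwx, hwy⟩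
  · rintro ⟨x, y⟩ - w ⟨hw1, hw2⟩ w' ⟨hw1', hw2'⟩
    have h3 : dist w w' ≤ c₂ * (2 * (k * r)) := by
      refine h.dist_le ?_ ?_
      · linarith [dist_triangle_right (e w).1 (e w').1 x]
      · linarith [dist_triangle_right (e w).2 (e w').2 y]
    nlinarith
  · rw [Finset.card_product, Nat.cast_mul, Real.rpow_add (by positivity)]
    refine (mul_le_mul hScard hTcard (Nat.cast_nonneg _) (by positivity)).trans (le_of_eq ?_)
    ring

/-- A cover of `E × F` with small `∑ r ^ (s + t)` gives a cover of `E` with small `∑ r ^ s` or a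
cover of `F` with small `∑ r ^ t`. If the latter does not exist, the fibres of the given
cover over the points of `E`, which all cover `F`, have `∑ r ^ t` bounded from below; so the
projections to `X`, weighted by `r ^ t`, form a fractional cover of `E`. -/
theorem ballCover_fst_or_snd (h : IsComparableProd e c₁ c₂) {E : Set X} {F : Set Y}
    {a b s t ε : ℝ} (ha : 0 < a) (hε : 0 < ε)
    (hcov : BallCover (e ⁻¹' (E ×ˢ F)) a b (s + t) (ε ^ 2)) :
    BallCover E (5 / c₁ * a) (5 / c₁ * b) s (5 ^ s * (1 / c₁) ^ (s + t) * ε) ∨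
      BallCover F (1 / c₁ * a) (1 / c₁ * b) t ε := by
  classical
  refine or_iff_not_imp_right.2 fun hF => ?_
  have h₁ := h.pos₁
  obtain ⟨J, hJ, hJcov, hJsum⟩ := hcov
  let x : Z × ℝ → X := fun p => (e p.1).1
  let r : Z × ℝ → ℝ := fun p => 1 / c₁ * max p.2 0
  have hJ0 : ∀ p ∈ J, 0 < p.2 := fun p hp => ha.trans_le (hJ p hp).2.1
  have hr : ∀ p ∈ J, r p = 1 / c₁ * p.2 := fun p hp => by simp only [r, max_eq_left (hJ0 p hp).le]
  have hr0 : ∀ p, 0 ≤ r p := fun p => by positivity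
  have hrpos : ∀ p ∈ J, 0 < r p := fun p hp => by
    rw [hr p hp]
    exact mul_pos (by positivity) (hJ0 p hp)
  have hsplit : ∀ p ∈ J, ∀ w : Z, dist w p.1 ≤ p.2 →
      dist (e w).1 (x p) ≤ r p ∧ dist (e w).2 (e p.1).2 ≤ r p := by
    intro p hp w hw
    have h3 : dist w p.1 / c₁ ≤ r p := by
      rw [hr p hp, one_div_mul_eq_div]
      exact div_le_div_of_nonneg_right hw h₁.le
    exact ⟨(h.dist_fst_le w p.1).trans h3, (h.dist_snd_le w p.1).trans h3⟩
  obtain ⟨u, huJ, hucov, husum⟩ := exists_cover_of_weighted x r (fun p => r p ^ s)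
    (fun p => Real.rpow_nonneg (hr0 p) _) E J (fun p => r p ^ t) ε
    (fun p hp => Real.rpow_pos_of_pos (hrpos p hp) _) hε (by
      intro y hy
      by_contra! hlt
      refine hF (ballCover_of_finset (J.filter fun p => dist y (x p) ≤ r p)
        (fun p => (e p.1).2) r (by positivity) ?_ ?_ hlt.le)
      · intro p hp
        obtain ⟨hp, -⟩ := Finset.mem_filter.1 hp
        obtain ⟨h3, h4, h5⟩ := hJ p hp
        rw [hr p hp]
        exact ⟨h3.2, mul_le_mul_of_nonneg_left h4 (by positivity),
          mul_le_mul_of_nonneg_left h5 (by positivity)⟩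
      · intro f hf
        obtain ⟨p, hp, hdist⟩ := hJcov (e.symm (y, f)) (by simpa using ⟨hy, hf⟩)
        have h3 := hsplit p hp _ hdist
        rw [e.apply_symm_apply] at h3
        exact ⟨p, Finset.mem_filter.2 ⟨hp, h3.1⟩, h3.2⟩)
  have hu : ∑ p ∈ u, r p ^ s ≤ (1 / c₁) ^ (s + t) * ε := by
    have h3 : ∑ p ∈ J, r p ^ t * r p ^ s = (1 / c₁) ^ (s + t) * ∑ p ∈ J, p.2 ^ (s + t) := by
      rw [Finset.mul_sum]
      refine Finset.sum_congr rfl fun p hp => ?_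
      rw [← Real.rpow_add (hrpos p hp), add_comm t s, hr p hp,
        Real.mul_rpow (by positivity) (hJ0 p hp).le]
    rw [h3] at husum
    have h4 : (1 / c₁) ^ (s + t) * ∑ p ∈ J, p.2 ^ (s + t) ≤ (1 / c₁) ^ (s + t) * ε ^ 2 :=
      mul_le_mul_of_nonneg_left hJsum (by positivity)
    refine le_of_mul_le_mul_left ?_ hε
    linarith
  refine ballCover_of_finset u x (fun p => 5 * r p) (by positivity) ?_ hucov ?_
  · intro p hp
    obtain ⟨h3, h4, h5⟩ := hJ p (huJ hp)
    have h6 : 5 * r p = 5 / c₁ * p.2 := by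
      rw [hr p (huJ hp)]
      ring
    rw [h6]
    exact ⟨h3.1, mul_le_mul_of_nonneg_left h4 (by positivity),
      mul_le_mul_of_nonneg_left h5 (by positivity)⟩
  · calc ∑ p ∈ u, (5 * r p) ^ s = 5 ^ s * ∑ p ∈ u, r p ^ s := by
          rw [Finset.mul_sum]
          exact Finset.sum_congr rfl fun p _ => Real.mul_rpow (by norm_num) (hr0 p)
      _ ≤ 5 ^ s * ((1 / c₁) ^ (s + t) * ε) := mul_le_mul_of_nonneg_left hu (by positivity)
      _ = 5 ^ s * (1 / c₁) ^ (s + t) * ε := (mul_assoc _ _ _).symm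

/-- Each ball of radius `r` in a cover of `E` is multiplied by an `r`-net of `F` of at most
`r ^ (-t)` points. -/
theorem ballCover_of_fst (h : IsComparableProd e c₁ c₂) {E : Set X} {F : Set Y}
    {a b s t ε : ℝ} (ha : 0 < a) (hF : ∀ r, 0 < r → r ≤ b → HasNet F r (r ^ (-t)))
    (hcov : BallCover E a b s ε) :
    BallCover (e ⁻¹' (E ×ˢ F)) (c₂ * a) (c₂ * b) (s + t) (c₂ ^ (s + t) * ε) := by
  classical
  have h₂ := h.pos₂
  obtain ⟨J, hJ, hJcov, hJsum⟩ := hcov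
  have hJ0 : ∀ p ∈ J, 0 < p.2 := fun p hp => ha.trans_le (hJ p hp).2.1
  have hT : ∀ p : X × ℝ, ∃ T : Finset Y, p ∈ J → ↑T ⊆ F ∧ (T.card : ℝ) ≤ p.2 ^ (-t) ∧
      ∀ y ∈ F, ∃ z ∈ T, dist y z ≤ p.2 := by
    intro p
    by_cases hp : p ∈ J
    · obtain ⟨T, hT⟩ := hF p.2 (hJ0 p hp) (hJ p hp).2.2
      exact ⟨T, fun _ => hT⟩
    · exact ⟨∅, fun h => absurd h hp⟩
  choose T hT using hT
  refine ballCover_of_finset (J.sigma T) (fun i => e.symm (i.1.1, i.2)) (fun i => c₂ * i.1.2)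
    (by positivity) ?_ ?_ ?_
  · rintro ⟨p, z⟩ hi
    obtain ⟨hp, hz⟩ := Finset.mem_sigma.1 hi
    obtain ⟨h3, h4, h5⟩ := hJ p hp
    refine ⟨?_, mul_le_mul_of_nonneg_left h4 h₂.le, mul_le_mul_of_nonneg_left h5 h₂.le⟩
    simpa using ⟨h3, (hT p hp).1 hz⟩
  · intro w hw
    obtain ⟨p, hp, hwp⟩ := hJcov (e w).1 hw.1
    obtain ⟨z, hz, hwz⟩ := (hT p hp).2.2 (e w).2 hw.2
    exact ⟨⟨p, z⟩, Finset.mem_sigma.2 ⟨hp, hz⟩, h.dist_le (by simpa using hwp) (by simpa using hwz)⟩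
  · rw [Finset.sum_sigma]
    calc ∑ p ∈ J, ∑ _z ∈ T p, (c₂ * p.2) ^ (s + t) ≤ ∑ p ∈ J, c₂ ^ (s + t) * p.2 ^ s := by
          refine Finset.sum_le_sum fun p hp => ?_
          have hp0 := hJ0 p hp
          rw [Finset.sum_const, nsmul_eq_mul]
          calc ((T p).card : ℝ) * (c₂ * p.2) ^ (s + t)
              ≤ p.2 ^ (-t) * (c₂ * p.2) ^ (s + t) :=
                mul_le_mul_of_nonneg_right (hT p hp).2.1 (by positivity)
            _ = c₂ ^ (s + t) * (p.2 ^ (-t) * p.2 ^ (s + t)) := by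
                rw [Real.mul_rpow h₂.le hp0.le]
                ring
            _ = c₂ ^ (s + t) * p.2 ^ s := by
                rw [← Real.rpow_add hp0]
                congr 2
                ring
      _ = c₂ ^ (s + t) * ∑ p ∈ J, p.2 ^ s := (Finset.mul_sum _ _ _).symm
      _ ≤ c₂ ^ (s + t) * ε := mul_le_mul_of_nonneg_left hJsum (by positivity)

end IsComparableProd

end Products

/-! ### Dimensions of products -/

theorem preimage_trans_prodComm {X Y Z : Type*} (e : Z ≃ X × Y) (E : Set X) (F : Set Y) :
    e.trans (Equiv.prodComm X Y) ⁻¹' (F ×ˢ E) = e ⁻¹' (E ×ˢ F) := by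
  ext z
  simp [and_comm]

section Infima

theorem two_mul_ereal (x : EReal) : 2 * x = x + x := by
  rw [← one_add_one_eq_two, EReal.right_distrib_of_nonneg zero_le_one zero_le_one, one_mul]

theorem sInf_add_sInf_le {A B C : Set ℝ} (hA : 0 ∉ A) (hB : 0 ∉ B) (hC : ∀ u ∈ C, 0 ≤ u)
    (h : ∀ s t : ℝ, 0 ≤ s → 0 ≤ t → s + t ∈ C → s ∈ A ∨ t ∈ B) :
    sInf ((fun s : ℝ => (s : EReal)) '' A) + sInf ((fun s : ℝ => (s : EReal)) '' B) ≤
      sInf ((fun s : ℝ => (s : EReal)) '' C) := by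
  refine le_sInf ?_
  rintro _ ⟨u, hu, rfl⟩
  have hu0 := hC u hu
  refine EReal.add_le_of_forall_lt fun a ha b hb => ?_
  -- it is enough to treat a real number between `max a 0` and `u`
  obtain ⟨s, hs0, hsu, hsA, has⟩ : ∃ s : ℝ, 0 ≤ s ∧ s ≤ u ∧ s ∉ A ∧ a ≤ s := by
    rcases le_or_gt a 0 with ha0 | ha0
    · exact ⟨0, le_rfl, hu0, hA, ha0⟩
    · have hau : u ∈ A := (h u 0 hu0 le_rfl (by simpa using hu)).resolve_right hB
      have hau' : a < (u : EReal) := ha.trans_le (sInf_le ⟨u, hau, rfl⟩)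
      lift a to ℝ using ⟨hau'.ne_top, (bot_le.trans_lt ha0).ne'⟩
      refine ⟨a, by exact_mod_cast ha0.le, by exact_mod_cast hau'.le, fun hmem => ?_, le_rfl⟩
      exact absurd ha (not_lt.2 (sInf_le ⟨a, hmem, rfl⟩))
  have hB' : u - s ∈ B := (h s (u - s) hs0 (by linarith) (by simpa using hu)).resolve_left hsA
  calc a + b ≤ (s : EReal) + ((u - s : ℝ) : EReal) :=
        add_le_add has (hb.le.trans (sInf_le ⟨_, hB', rfl⟩))
    _ = (u : EReal) := by
        rw [← EReal.coe_add]
        congr 1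
        ring

theorem sInf_le_sInf_add {A C : Set ℝ} {d : EReal} (hA : ∀ s ∈ A, 0 ≤ s) (hd : 0 ≤ d)
    (h : ∀ s ∈ A, ∀ t : ℝ, 0 ≤ t → d < t → s + t ∈ C) :
    sInf ((fun s : ℝ => (s : EReal)) '' C) ≤ sInf ((fun s : ℝ => (s : EReal)) '' A) + d := by
  have hA0 : (0 : EReal) ≤ sInf ((fun s : ℝ => (s : EReal)) '' A) := by
    refine le_sInf ?_
    rintro _ ⟨s, hs, rfl⟩
    exact EReal.coe_nonneg.2 (hA s hs)
  refine EReal.le_add_of_forall_gt (Or.inl (EReal.bot_lt_zero.trans_le hA0).ne')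
    (Or.inr (EReal.bot_lt_zero.trans_le hd).ne') fun a ha b hb => ?_
  obtain ⟨_, ⟨s, hs, rfl⟩, hsa⟩ := sInf_lt_iff.1 ha
  obtain ⟨t, hdt, htb⟩ := EReal.lt_iff_exists_real_btwn.1 hb
  have ht : 0 ≤ t := by exact_mod_cast hd.trans hdt.le
  have hst : sInf ((fun s : ℝ => (s : EReal)) '' C) ≤ ((s + t : ℝ) : EReal) :=
    sInf_le ⟨s + t, h s hs t ht hdt, rfl⟩
  refine hst.trans ?_
  rw [EReal.coe_add]
  exact add_le_add hsa.le htb.le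

end Infima

namespace IsComparableProd

variable {X Y Z : Type*} [MetricSpace X] [MetricSpace Y] [MetricSpace Z]
variable {e : Z ≃ X × Y} {c₁ c₂ : ℝ} {E : Set X} {F : Set Y} {Φ : ℝ → ℝ}

theorem eventually_ballCover_fst_or_snd (h : IsComparableProd e c₁ c₂) (hE : Doubling E)
    (hF : Doubling F) (hΦ : Admissible Φ) {s t : ℝ} (hs : 0 ≤ s) (ht : 0 ≤ t) {η : ℝ}
    (hη : 0 < η) : ∃ ε : ℝ, 0 < ε ∧ ∀ᶠ δ in 𝓝[>] (0 : ℝ),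
      BallCover (e ⁻¹' (E ×ˢ F)) (Φ δ) δ (s + t) ε →
        BallCover E (Φ δ) δ s η ∨ BallCover F (Φ δ) δ t η := by
  have h₁ := h.pos₁
  obtain ⟨C, hC, hCE⟩ := exists_eventually_ballCover_rescale hE hΦ hs (k₁ := 5 / c₁)
    (k₂ := 5 / c₁) (l₁ := 1) (l₂ := 1) (by positivity) one_pos one_pos
  obtain ⟨D, hD, hDF⟩ := exists_eventually_ballCover_rescale hF hΦ ht (k₁ := 1 / c₁)
    (k₂ := 1 / c₁) (l₁ := 1) (l₂ := 1) (by positivity) one_pos one_pos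
  let C' := C * (5 ^ s * (1 / c₁) ^ (s + t))
  have hC' : 0 < C' := by positivity
  refine ⟨(min (η / C') (η / D)) ^ 2, by positivity, ?_⟩
  filter_upwards [hCE, hDF, hΦ.eventually_pos] with δ hδE hδF hδ hcov
  refine (h.ballCover_fst_or_snd hδ.2 (by positivity) hcov).imp (fun h1 => ?_) fun h1 => ?_
  · have h2 := hδE _ h1
    simp only [one_mul] at h2
    refine h2.mono ?_
    rw [← mul_assoc, ← le_div_iff₀' hC']
    exact min_le_left _ _
  · have h2 := hδF _ h1
    simp only [one_mul] at h2
    refine h2.mono ?_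
    rw [← le_div_iff₀' hD]
    exact min_le_right _ _

theorem exists_eventually_ballCover_of_fst (h : IsComparableProd e c₁ c₂)
    (hEF : Doubling (e ⁻¹' (E ×ˢ F))) (hΦ : Admissible Φ) {s t : ℝ} (hst : 0 ≤ s + t)
    (ht : upperBoxDim F < t) : ∃ C : ℝ, 0 < C ∧ ∀ᶠ δ in 𝓝[>] (0 : ℝ), ∀ ε : ℝ, 0 < ε →
      BallCover E (Φ δ) δ s ε → BallCover (e ⁻¹' (E ×ˢ F)) (Φ δ) δ (s + t) (C * ε) := by
  have h₂ := h.pos₂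
  obtain ⟨C, hC, hCE⟩ := exists_eventually_ballCover_rescale hEF hΦ hst (k₁ := c₂)
    (k₂ := c₂) (l₁ := 1) (l₂ := 1) h₂ one_pos one_pos
  obtain ⟨δ₀, hδ₀, -, hnet⟩ := eventually_nhdsGT_zero_iff.1 (eventually_hasNet_of_upperBoxDim_lt ht)
  refine ⟨C * c₂ ^ (s + t), by positivity, ?_⟩
  filter_upwards [hCE, hΦ.eventually_pos, Ioo_mem_nhdsGT hδ₀] with δ h1 h2 h3 ε _ hcov
  simpa [mul_assoc] using h1 _ (h.ballCover_of_fst h2.2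
    (fun r hr hrδ => hnet r hr (hrδ.trans_lt h3.2)) hcov)

theorem mem_upperExponents_or_mem_lowerExponents (h : IsComparableProd e c₁ c₂) (hE : Doubling E)
    (hF : Doubling F) (hΦ : Admissible Φ) {s t : ℝ} (hs : 0 ≤ s) (ht : 0 ≤ t)
    (hst : s + t ∈ upperExponents Φ (e ⁻¹' (E ×ˢ F))) :
    s ∈ upperExponents Φ E ∨ t ∈ lowerExponents Φ F := by
  by_contra! hcon
  simp only [upperExponents, lowerExponents, Set.mem_ofPred_eq, hs, ht, true_and, not_forall,
    not_frequently] at hcon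
  obtain ⟨⟨η, hη, h1⟩, η', hη', h2⟩ := hcon
  obtain ⟨ε, hε, h3⟩ := h.eventually_ballCover_fst_or_snd hE hF hΦ hs ht (lt_min hη hη')
  refine h1 ?_
  filter_upwards [h2, h3, hst.2 ε hε] with δ hδ2 hδ3 hδ
  exact ((hδ3 hδ).resolve_right fun h4 => hδ2 (h4.mono (min_le_right _ _))).mono (min_le_left _ _)

theorem mem_lowerExponents_or_mem_lowerExponents (h : IsComparableProd e c₁ c₂) (hE : Doubling E)
    (hF : Doubling F) (hΦ : Admissible Φ) {s t : ℝ} (hs : 0 ≤ s) (ht : 0 ≤ t)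
    (hst : s + t ∈ lowerExponents Φ (e ⁻¹' (E ×ˢ F))) :
    s ∈ lowerExponents Φ E ∨ t ∈ lowerExponents Φ F := by
  by_contra! hcon
  simp only [lowerExponents, Set.mem_ofPred_eq, hs, ht, true_and, not_forall,
    not_frequently] at hcon
  obtain ⟨⟨η, hη, h1⟩, η', hη', h2⟩ := hcon
  obtain ⟨ε, hε, h3⟩ := h.eventually_ballCover_fst_or_snd hE hF hΦ hs ht (lt_min hη hη')
  refine hst.2 ε hε ?_
  filter_upwards [h1, h2, h3] with δ hδ1 hδ2 hδ3 hδ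
  exact (hδ3 hδ).elim (fun h4 => hδ1 (h4.mono (min_le_left _ _)))
    fun h4 => hδ2 (h4.mono (min_le_right _ _))

theorem add_mem_upperExponents (h : IsComparableProd e c₁ c₂)
    (hEF : Doubling (e ⁻¹' (E ×ˢ F))) (hΦ : Admissible Φ) {s t : ℝ}
    (hs : s ∈ upperExponents Φ E) (ht0 : 0 ≤ t) (ht : upperBoxDim F < t) :
    s + t ∈ upperExponents Φ (e ⁻¹' (E ×ˢ F)) := by
  have hst : 0 ≤ s + t := add_nonneg hs.1 ht0
  obtain ⟨C, hC, h1⟩ := h.exists_eventually_ballCover_of_fst hEF hΦ hst ht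
  exact ⟨hst, forall_eventually_of_scaled hC h1 hs.2⟩

theorem add_mem_lowerExponents (h : IsComparableProd e c₁ c₂)
    (hEF : Doubling (e ⁻¹' (E ×ˢ F))) (hΦ : Admissible Φ) {s t : ℝ}
    (hs : s ∈ lowerExponents Φ E) (ht0 : 0 ≤ t) (ht : upperBoxDim F < t) :
    s + t ∈ lowerExponents Φ (e ⁻¹' (E ×ˢ F)) := by
  have hst : 0 ≤ s + t := add_nonneg hs.1 ht0
  obtain ⟨C, hC, h1⟩ := h.exists_eventually_ballCover_of_fst hEF hΦ hst ht
  exact ⟨hst, forall_frequently_of_scaled hC h1 hs.2⟩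

end IsComparableProd

/-- The standing assumptions on the sets `E` and `F`: non-empty, totally bounded, and of finite
Assouad dimension. -/
structure IsTame {X : Type*} [MetricSpace X] (F : Set X) : Prop where
  nonempty : F.Nonempty
  totallyBounded : TotallyBounded F
  assouadDim_lt_top : assouadDim F < ⊤

theorem IsComparableProd.isTame {X Y Z : Type*} [MetricSpace X] [MetricSpace Y] [MetricSpace Z]
    {e : Z ≃ X × Y} {c₁ c₂ : ℝ} {E : Set X} {F : Set Y} (h : IsComparableProd e c₁ c₂)
    (hE : IsTame E) (hF : IsTame F) : IsTame (e ⁻¹' (E ×ˢ F)) where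
  nonempty := (hE.nonempty.prod hF.nonempty).preimage e.surjective
  totallyBounded := h.totallyBounded hE.totallyBounded hF.totallyBounded
  assouadDim_lt_top := h.assouadDim_lt_top hE.assouadDim_lt_top hF.assouadDim_lt_top

theorem IsTame.doubling {X : Type*} [MetricSpace X] {F : Set X} (hF : IsTame F) : Doubling F :=
  doubling_of_assouadDim_lt_top hF.assouadDim_lt_top

namespace IsComparableProd

variable {X Y Z : Type*} [MetricSpace X] [MetricSpace Y] [MetricSpace Z] [Nontrivial X]
  [Nontrivial Y] {e : Z ≃ X × Y} {c₁ c₂ : ℝ} {E : Set X} {F : Set Y} {Φ : ℝ → ℝ}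

theorem upperDim_add_lowerDim_le (h : IsComparableProd e c₁ c₂) (hX : UniformlyPerfect X)
    (hY : UniformlyPerfect Y) (hE : IsTame E) (hF : IsTame F) (hΦ : Admissible Φ) :
    upperDim Φ E + lowerDim Φ F ≤ upperDim Φ (e ⁻¹' (E ×ˢ F)) := by
  have := e.nontrivial
  have hEF := h.isTame hE hF
  rw [upperDim_eq_sInf hX hE.doubling hE.totallyBounded hΦ,
    lowerDim_eq_sInf hY hF.doubling hF.totallyBounded hΦ,
    upperDim_eq_sInf (h.uniformlyPerfect hX hY) hEF.doubling hEF.totallyBounded hΦ]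
  exact sInf_add_sInf_le (zero_notMem_upperExponents hE.nonempty Φ)
    (zero_notMem_lowerExponents hF.nonempty Φ) (fun u hu => hu.1)
    fun s t hs ht => h.mem_upperExponents_or_mem_lowerExponents hE.doubling hF.doubling hΦ hs ht

theorem lowerDim_add_upperDim_le (h : IsComparableProd e c₁ c₂) (hX : UniformlyPerfect X)
    (hY : UniformlyPerfect Y) (hE : IsTame E) (hF : IsTame F) (hΦ : Admissible Φ) :
    lowerDim Φ E + upperDim Φ F ≤ upperDim Φ (e ⁻¹' (E ×ˢ F)) := by
  have h1 := h.swap.upperDim_add_lowerDim_le hY hX hF hE hΦ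
  rwa [preimage_trans_prodComm, add_comm] at h1

theorem lowerDim_add_lowerDim_le (h : IsComparableProd e c₁ c₂) (hX : UniformlyPerfect X)
    (hY : UniformlyPerfect Y) (hE : IsTame E) (hF : IsTame F) (hΦ : Admissible Φ) :
    lowerDim Φ E + lowerDim Φ F ≤ lowerDim Φ (e ⁻¹' (E ×ˢ F)) := by
  have := e.nontrivial
  have hEF := h.isTame hE hF
  rw [lowerDim_eq_sInf hX hE.doubling hE.totallyBounded hΦ,
    lowerDim_eq_sInf hY hF.doubling hF.totallyBounded hΦ,
    lowerDim_eq_sInf (h.uniformlyPerfect hX hY) hEF.doubling hEF.totallyBounded hΦ]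
  exact sInf_add_sInf_le (zero_notMem_lowerExponents hE.nonempty Φ)
    (zero_notMem_lowerExponents hF.nonempty Φ) (fun u hu => hu.1)
    fun s t hs ht => h.mem_lowerExponents_or_mem_lowerExponents hE.doubling hF.doubling hΦ hs ht

theorem upperDim_le_upperDim_add_upperBoxDim (h : IsComparableProd e c₁ c₂)
    (hX : UniformlyPerfect X) (hY : UniformlyPerfect Y) (hE : IsTame E) (hF : IsTame F)
    (hΦ : Admissible Φ) :
    upperDim Φ (e ⁻¹' (E ×ˢ F)) ≤ upperDim Φ E + upperBoxDim F := by
  have := e.nontrivial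
  have hEF := h.isTame hE hF
  rw [upperDim_eq_sInf hX hE.doubling hE.totallyBounded hΦ,
    upperDim_eq_sInf (h.uniformlyPerfect hX hY) hEF.doubling hEF.totallyBounded hΦ]
  exact sInf_le_sInf_add (fun s hs => hs.1) (upperBoxDim_nonneg hF.nonempty)
    fun s hs t ht0 ht => h.add_mem_upperExponents hEF.doubling hΦ hs ht0 ht

theorem lowerDim_le_lowerDim_add_upperBoxDim (h : IsComparableProd e c₁ c₂)
    (hX : UniformlyPerfect X) (hY : UniformlyPerfect Y) (hE : IsTame E) (hF : IsTame F)
    (hΦ : Admissible Φ) :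
    lowerDim Φ (e ⁻¹' (E ×ˢ F)) ≤ lowerDim Φ E + upperBoxDim F := by
  have := e.nontrivial
  have hEF := h.isTame hE hF
  rw [lowerDim_eq_sInf hX hE.doubling hE.totallyBounded hΦ,
    lowerDim_eq_sInf (h.uniformlyPerfect hX hY) hEF.doubling hEF.totallyBounded hΦ]
  exact sInf_le_sInf_add (fun s hs => hs.1) (upperBoxDim_nonneg hF.nonempty)
    fun s hs t ht0 ht => h.add_mem_lowerExponents hEF.doubling hΦ hs ht0 ht

theorem upperDim_le_upperBoxDim_add_upperDim (h : IsComparableProd e c₁ c₂)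
    (hX : UniformlyPerfect X) (hY : UniformlyPerfect Y) (hE : IsTame E) (hF : IsTame F)
    (hΦ : Admissible Φ) :
    upperDim Φ (e ⁻¹' (E ×ˢ F)) ≤ upperBoxDim E + upperDim Φ F := by
  have h1 := h.swap.upperDim_le_upperDim_add_upperBoxDim hY hX hF hE hΦ
  rwa [preimage_trans_prodComm, add_comm] at h1

theorem lowerDim_le_upperBoxDim_add_lowerDim (h : IsComparableProd e c₁ c₂)
    (hX : UniformlyPerfect X) (hY : UniformlyPerfect Y) (hE : IsTame E) (hF : IsTame F)
    (hΦ : Admissible Φ) :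
    lowerDim Φ (e ⁻¹' (E ×ˢ F)) ≤ upperBoxDim E + lowerDim Φ F := by
  have h1 := h.swap.lowerDim_le_lowerDim_add_upperBoxDim hY hX hF hE hΦ
  rwa [preimage_trans_prodComm, add_comm] at h1

/-- For a self-product both alternatives of `eventually_ballCover_fst_or_snd` concern the same
set at the same scale, which is why the upper dimension is doubled here, rather than added to
the lower one. -/
theorem two_mul_upperDim_le {e : Z ≃ Y × Y} (h : IsComparableProd e c₁ c₂)
    (hY : UniformlyPerfect Y) (hF : IsTame F) (hΦ : Admissible Φ) :
    2 * upperDim Φ F ≤ upperDim Φ (e ⁻¹' (F ×ˢ F)) := by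
  have := e.nontrivial
  have hFF := h.isTame hF hF
  rw [upperDim_eq_sInf hY hF.doubling hF.totallyBounded hΦ,
    upperDim_eq_sInf (h.uniformlyPerfect hY hY) hFF.doubling hFF.totallyBounded hΦ]
  refine le_sInf ?_
  rintro _ ⟨u, hu, rfl⟩
  have hu0 : 0 ≤ u / 2 := div_nonneg hu.1 (by norm_num)
  have hmem : u / 2 ∈ upperExponents Φ F := by
    refine ⟨hu0, fun η hη => ?_⟩
    obtain ⟨ε, hε, h1⟩ :=
      h.eventually_ballCover_fst_or_snd hF.doubling hF.doubling hΦ hu0 hu0 hη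
    filter_upwards [h1, hu.2 ε hε] with δ h2 h3
    rw [add_halves, or_self] at h2
    exact h2 h3
  rw [two_mul_ereal]
  have hle : sInf ((fun s : ℝ => (s : EReal)) '' upperExponents Φ F) ≤ ((u / 2 : ℝ) : EReal) :=
    sInf_le ⟨_, hmem, rfl⟩
  refine (add_le_add hle hle).trans (le_of_eq ?_)
  rw [← EReal.coe_add, add_halves]

theorem two_mul_lowerDim_le {e : Z ≃ Y × Y} (h : IsComparableProd e c₁ c₂)
    (hY : UniformlyPerfect Y) (hF : IsTame F) (hΦ : Admissible Φ) :
    2 * lowerDim Φ F ≤ lowerDim Φ (e ⁻¹' (F ×ˢ F)) := by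
  rw [two_mul_ereal]
  exact h.lowerDim_add_lowerDim_le hY hY hF hF hΦ

end IsComparableProd

theorem ComparableToMax.isComparableProd {X Y : Type*} [MetricSpace X] [MetricSpace Y]
    {m : MetricSpace (X × Y)} (hm : ComparableToMax m) :
    ∃ c₁ c₂ : ℝ, @IsComparableProd X Y (X × Y) _ _ m (Equiv.refl _) c₁ c₂ := by
  obtain ⟨c₁, c₂, h₁, h₂, h⟩ := hm
  exact ⟨c₁, c₂, @IsComparableProd.mk X Y (X × Y) _ _ m (Equiv.refl _) c₁ c₂ h₁ h₂
    (fun p q => (h p q).1) fun p q => (h p q).2⟩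

end PhiInter

theorem theorem5p5 {X Y : Type*} [MetricSpace X] [MetricSpace Y] [Nontrivial X] [Nontrivial Y]
    (hX : PhiInter.UniformlyPerfect X) (hY : PhiInter.UniformlyPerfect Y) :
    -- general products
    (∀ m : MetricSpace (X × Y), PhiInter.ComparableToMax m →
      @PhiInter.UniformlyPerfect (X × Y) m ∧ Nontrivial (X × Y) ∧
      ∀ (E : Set X) (F : Set Y), E.Nonempty → F.Nonempty → TotallyBounded E → TotallyBounded F →
        PhiInter.assouadDim E < ⊤ → PhiInter.assouadDim F < ⊤ →
        (E ×ˢ F).Nonempty ∧ @TotallyBounded (X × Y) m.toUniformSpace (E ×ˢ F) ∧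
        @PhiInter.assouadDim (X × Y) m (E ×ˢ F) < ⊤ ∧
        ∀ Φ : ℝ → ℝ, PhiInter.Admissible Φ →
          @PhiInter.lowerDim (X × Y) m Φ (E ×ˢ F) ≤ @PhiInter.upperDim (X × Y) m Φ (E ×ˢ F) ∧
          -- (i)
          (max (PhiInter.upperDim Φ E + PhiInter.lowerDim Φ F)
              (PhiInter.lowerDim Φ E + PhiInter.upperDim Φ F)
              ≤ @PhiInter.upperDim (X × Y) m Φ (E ×ˢ F) ∧
            @PhiInter.upperDim (X × Y) m Φ (E ×ˢ F)
              ≤ min (PhiInter.upperDim Φ E + PhiInter.upperBoxDim F)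
                  (PhiInter.upperBoxDim E + PhiInter.upperDim Φ F)) ∧
          -- (ii)
          (PhiInter.lowerDim Φ E + PhiInter.lowerDim Φ F
              ≤ @PhiInter.lowerDim (X × Y) m Φ (E ×ˢ F) ∧
            @PhiInter.lowerDim (X × Y) m Φ (E ×ˢ F)
              ≤ min (PhiInter.lowerDim Φ E + PhiInter.upperBoxDim F)
                  (PhiInter.upperBoxDim E + PhiInter.lowerDim Φ F))) ∧
    -- self-products
    (∀ m : MetricSpace (Y × Y), PhiInter.ComparableToMax m →
      ∀ F : Set Y, F.Nonempty → TotallyBounded F → PhiInter.assouadDim F < ⊤ →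
        ∀ Φ : ℝ → ℝ, PhiInter.Admissible Φ →
          @PhiInter.lowerDim (Y × Y) m Φ (F ×ˢ F) ≤ @PhiInter.upperDim (Y × Y) m Φ (F ×ˢ F) ∧
          -- (iii)
          (2 * PhiInter.upperDim Φ F ≤ @PhiInter.upperDim (Y × Y) m Φ (F ×ˢ F) ∧
            @PhiInter.upperDim (Y × Y) m Φ (F ×ˢ F)
              ≤ PhiInter.upperDim Φ F + PhiInter.upperBoxDim F) ∧
          -- (iv)
          (2 * PhiInter.lowerDim Φ F ≤ @PhiInter.lowerDim (Y × Y) m Φ (F ×ˢ F) ∧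
            @PhiInter.lowerDim (Y × Y) m Φ (F ×ˢ F)
              ≤ PhiInter.lowerDim Φ F + PhiInter.upperBoxDim F)) := by
  refine ⟨fun m hm => ?_, fun m hm F hF hFb hFa Φ hΦ => ?_⟩
  · obtain ⟨c₁, c₂, h⟩ := hm.isComparableProd
    refine ⟨h.uniformlyPerfect hX hY, inferInstance, fun E F hE hF hEb hFb hEa hFa => ?_⟩
    have tE : PhiInter.IsTame E := ⟨hE, hEb, hEa⟩
    have tF : PhiInter.IsTame F := ⟨hF, hFb, hFa⟩
    refine ⟨hE.prod hF, h.totallyBounded hEb hFb, h.assouadDim_lt_top hEa hFa, fun Φ hΦ => ?_⟩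
    exact ⟨PhiInter.lowerDim_le_upperDim Φ _,
      ⟨max_le (h.upperDim_add_lowerDim_le hX hY tE tF hΦ)
        (h.lowerDim_add_upperDim_le hX hY tE tF hΦ),
      le_min (h.upperDim_le_upperDim_add_upperBoxDim hX hY tE tF hΦ)
        (h.upperDim_le_upperBoxDim_add_upperDim hX hY tE tF hΦ)⟩,
      h.lowerDim_add_lowerDim_le hX hY tE tF hΦ,
      le_min (h.lowerDim_le_lowerDim_add_upperBoxDim hX hY tE tF hΦ)
        (h.lowerDim_le_upperBoxDim_add_lowerDim hX hY tE tF hΦ)⟩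
  · obtain ⟨c₁, c₂, h⟩ := hm.isComparableProd
    have tF : PhiInter.IsTame F := ⟨hF, hFb, hFa⟩
    exact ⟨PhiInter.lowerDim_le_upperDim Φ _,
      ⟨h.two_mul_upperDim_le hY tF hΦ, h.upperDim_le_upperDim_add_upperBoxDim hY hY tF tF hΦ⟩,
      h.two_mul_lowerDim_le hY tF hΦ, h.lowerDim_le_lowerDim_add_upperBoxDim hY hY tF tF hΦ⟩
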